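/- Let $G$ be a compact (Hausdorff) group, and let $\hat G$ be the set of equivalence classes of irreducible finite-dimensional unitary representations of $G$, with a fixed representative $(\pi,V_\pi)$ in each class. A C$^*$-dynamical system $(\mathcal A,G,\alpha)$ consists of a unital C$^*$-algebra $\mathcal A$ and an action $\alpha$ of $G$ on $\mathcal A$ by $*$-automorphisms such that $g\mapsto\alpha_g(x)$ is norm continuous for every $x\in\mathcal A$. For a finite-dimensional unitary representation $(\pi,V)$ of $G$ put $$A_2(\pi)=\{x\in\mathcal A\otimes\operatorname{End}(V)\mid \pi_g\cdot\alpha_g(x)=x\ \text{ for all } g\in G\},$$ where $\alpha_g$ acts on the first tensor factor. A non-degenerate isometry in $A_2(\pi)$ is an element $s\in A_2(\pi)$ with $s^*s=1$ and $ss^*x=x$ for all $x\in A_2(\pi)$. The system is weakly cleft if $A_2(\pi)$ contains a non-degenerate isometry for every irreducible $\pi$. Any family $x_\pi\in\mathcal A\otimes\operatorname{End}(V_\pi)$, $\pi\in\hat G$, is extended to arbitrary finite-dimensional unitary representations $(\pi,V)$ by $x_\pi=\sum_k v_k x_{\sigma_k}v_k^*$, where $v_k:V_{\sigma_k}\to V$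 are isometric intertwiners decomposing $\pi$ into irreducible representations $\sigma_k\in\hat G$; this does not depend on the decomposition. The same convention is used with $\mathcal B$ in place of $\mathcal A$. Let $(\mathcal A,G,\alpha)$ be weakly cleft with fixed point algebra $\mathcal B=\mathcal A^G$. A factor system associated with it is a pair $(\gamma,\omega)$ which, for some family of non-degenerate isometries $s_\pi\in A_2(\pi)$, $\pi\in\hat G$, with $s_1=1$ for the trivial representation, is given by $$\gamma_\pi:\mathcal B\to\mathcal B\otimes\operatorname{End}(V_\pi),\quad \gamma_\pi(b)=s_\pi^*(b\otimes 1)s_\pi,\qquad \omega(\pi,\rho)=s_{\pi\otimes\rho}^*\,(s_\pi)_{12}\,(s_\rho)_{13}\in\mathcal B\otimes\operatorname{End}(V_\pi\otimes V_\rho)$$ for $\pi,\rho\in\hat G$ (leg numbering notation). Theorem. Let $(\mathcal A,G,\alpha)$ and $(\mathcal A',G,\alpha')$ be weakly cleft C$^*$-dynamical systems with the same fixed point algebra $\mathcal B$ (a unital C$^*$-algebra identified with both $\mathcal A^G$ and $(\mathcal A')^G$), and let $(\gamma,\omega)$ and $(\gamma',\omega')$ be factor systems associated with them, respectively. Then the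 following are equivalent: (i) The systems are equivalent (over $\mathcal B$): there is a $*$-isomorphism $\varphi:\mathcal A\to\mathcal A'$ with $\varphi\circ\alpha_g=\alpha'_g\circ\varphi$ for all $g\in G$ and $\varphi(b)=b$ for all $b\in\mathcal B$. (ii) The factor systems are conjugated: there are unitaries $v_\pi\in\mathcal B\otimes\operatorname{End}(V_\pi)$, $\pi\in\hat G$, such that for all $\pi,\rho\in\hat G$ and $b\in\mathcal B$ $$\gamma'_\pi(b)=v_\pi^*\,\gamma_\pi(b)\,v_\pi,\qquad v_{\pi\otimes\rho}\,\omega'(\pi,\rho)=\omega(\pi,\rho)\,(\mathrm{id}_\pi\otimes\gamma_\rho)(v_\pi)\,(v_\rho)_{13},$$ where $(\mathrm{id}_\pi\otimes\gamma_\rho)(v_\pi)$ is regarded as an element of $\mathcal B\otimes\operatorname{End}(V_\pi)\otimes\operatorname{End}(V_\rho)$. -/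

import Mathlib

open scoped Matrix Kronecker

/-!
Throughout, `A ⊗ End(V)` for `V = ℂⁿ` (with an index type `n` of the standard orthonormal basis) is
written as the star-algebra `Matrix n n A`, and `A ⊗ End(V) ⊗ End(W)` as `Matrix (n × m) (n × m) A`.
-/

section Representations

/-- A finite-dimensional (continuous) unitary representation of `G` on the Hilbert space `ℂⁿ`,
in the form of unitary matrices. -/
structure UnitaryRep (G : Type*) [Group G] [TopologicalSpace G]
    (n : Type*) [Fintype n] [DecidableEq n] where
  toHom : G →* Matrix.unitaryGroup n ℂ
  continuous_toHom : Continuous fun g => (toHom g : Matrix n n ℂ)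

namespace UnitaryRep

variable {G : Type*} [Group G] [TopologicalSpace G]
variable {n : Type*} [Fintype n] [DecidableEq n] {m : Type*} [Fintype m] [DecidableEq m]

/-- The unitary matrix `π_g`. -/
def mat (π : UnitaryRep G n) (g : G) : Matrix n n ℂ := (π.toHom g : Matrix n n ℂ)

theorem mat_one (π : UnitaryRep G n) : π.mat 1 = 1 := by simp [mat]

theorem mat_mul (π : UnitaryRep G n) (g h : G) : π.mat (g * h) = π.mat g * π.mat h := by
  simp [mat]

theorem mat_mem (π : UnitaryRep G n) (g : G) : π.mat g ∈ Matrix.unitaryGroup n ℂ :=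
  (π.toHom g).2

theorem conjTranspose_mat (π : UnitaryRep G n) (g : G) : (π.mat g)ᴴ = π.mat g⁻¹ := by
  have h1 : (π.mat g)ᴴ * π.mat g = 1 := (π.mat_mem g).1
  have h2 : π.mat g * π.mat g⁻¹ = 1 := by rw [← mat_mul, mul_inv_cancel, mat_one]
  calc (π.mat g)ᴴ = (π.mat g)ᴴ * (π.mat g * π.mat g⁻¹) := by rw [h2, mul_one]
    _ = π.mat g⁻¹ := by rw [← mul_assoc, h1, one_mul]

theorem continuous_mat (π : UnitaryRep G n) : Continuous π.mat := π.continuous_toHom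

/-- The underlying linear representation on `ℂⁿ`. -/
noncomputable def toRepresentation (π : UnitaryRep G n) : Representation ℂ G (n → ℂ) where
  toFun g := Matrix.toLin' (π.mat g)
  map_one' := by rw [mat_one, Matrix.toLin'_one]; rfl
  map_mul' g h := by rw [mat_mul, Matrix.toLin'_mul]; rfl

/-- Irreducibility: the space is nonzero, and has no proper nonzero invariant subspace. -/
def IsIrreducible (π : UnitaryRep G n) : Prop := π.toRepresentation.IsIrreducible

/-- Unitary equivalence of representations. -/
def Equivalent (π : UnitaryRep G n) (ρ : UnitaryRep G m) : Prop :=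
  ∃ u : Matrix m n ℂ, uᴴ * u = 1 ∧ u * uᴴ = 1 ∧ ∀ g, u * π.mat g = ρ.mat g * u

theorem Equivalent.refl (π : UnitaryRep G n) : π.Equivalent π :=
  ⟨1, by simp, by simp, by simp⟩

theorem Equivalent.symm {π : UnitaryRep G n} {ρ : UnitaryRep G m} (h : π.Equivalent ρ) :
    ρ.Equivalent π := by
  obtain ⟨u, h1, h2, h3⟩ := h
  refine ⟨uᴴ, by simpa using h2, by simpa using h1, fun g => ?_⟩
  calc uᴴ * ρ.mat g = uᴴ * (ρ.mat g * u) * uᴴ := by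
        rw [Matrix.mul_assoc, Matrix.mul_assoc, h2, Matrix.mul_one]
    _ = π.mat g * uᴴ := by
        rw [← h3, ← Matrix.mul_assoc uᴴ, h1, Matrix.one_mul]

theorem Equivalent.trans {l : Type*} [Fintype l] [DecidableEq l] {π : UnitaryRep G n}
    {ρ : UnitaryRep G m} {σ : UnitaryRep G l} (h : π.Equivalent ρ) (h' : ρ.Equivalent σ) :
    π.Equivalent σ := by
  obtain ⟨u, h1, h2, h3⟩ := h
  obtain ⟨v, k1, k2, k3⟩ := h'
  refine ⟨v * u, ?_, ?_, fun g => ?_⟩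
  · rw [Matrix.conjTranspose_mul, Matrix.mul_assoc, ← Matrix.mul_assoc vᴴ, k1, Matrix.one_mul, h1]
  · rw [Matrix.conjTranspose_mul, Matrix.mul_assoc, ← Matrix.mul_assoc u, h2, Matrix.one_mul, k2]
  · rw [Matrix.mul_assoc, h3, ← Matrix.mul_assoc, k3, Matrix.mul_assoc]

/-- The tensor product representation `π ⊗ ρ`. -/
def tensor (π : UnitaryRep G n) (ρ : UnitaryRep G m) : UnitaryRep G (n × m) where
  toHom :=
    { toFun := fun g => ⟨π.mat g ⊗ₖ ρ.mat g,
        Matrix.kronecker_mem_unitary (π.mat_mem g) (ρ.mat_mem g)⟩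
      map_one' := by
        apply Subtype.ext
        simp [mat_one]
      map_mul' := fun g h => by
        apply Subtype.ext
        simp [mat_mul, Matrix.mul_kronecker_mul] }
  continuous_toHom := by
    refine continuous_matrix fun i j => ?_
    exact (π.continuous_mat.matrix_elem i.1 j.1).mul (ρ.continuous_mat.matrix_elem i.2 j.2)

end UnitaryRep

/-- Irreducible unitary representations of `G` on the spaces `ℂᵈ`, `d ∈ ℕ`. -/
def IrrepObj (G : Type*) [Group G] [TopologicalSpace G] : Type _ :=
  {p : Σ d : ℕ, UnitaryRep G (Fin d) // p.2.IsIrreducible}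

/-- Unitary equivalence as an equivalence relation. -/
instance IrrepObj.setoid (G : Type*) [Group G] [TopologicalSpace G] : Setoid (IrrepObj G) where
  r p q := p.1.2.Equivalent q.1.2
  iseqv := ⟨fun p => .refl p.1.2, fun h => h.symm, fun h h' => h.trans h'⟩

/-- The set of equivalence classes of irreducible unitary representations of `G`. -/
def UnitaryDual (G : Type*) [Group G] [TopologicalSpace G] : Type _ :=
  Quotient (IrrepObj.setoid G)

namespace UnitaryDual

variable {G : Type*} [Group G] [TopologicalSpace G]

/-- The dimension `d_σ`. -/
noncomputable def dim (σ : UnitaryDual G) : ℕ := (Quotient.out σ).1.1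

/-- The chosen representative of the class `σ`. -/
noncomputable def rep (σ : UnitaryDual G) : UnitaryRep G (Fin σ.dim) := (Quotient.out σ).1.2

end UnitaryDual

/-- A decomposition of a representation `π` into irreducible ones: isometric intertwiners
`v_k : V_{σ_k} → V_π` whose ranges decompose `V_π` (the `v_k v_k*` are then automatically mutually
orthogonal projections). -/
structure IrrepDecomposition {G : Type*} [Group G] [TopologicalSpace G]
    {n : Type*} [Fintype n] [DecidableEq n] (π : UnitaryRep G n) where
  index : Type
  [fintypeIndex : Fintype index]
  cls : index → UnitaryDual G
  isom : ∀ k, Matrix n (Fin (cls k).dim) ℂ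
  isom_isometry : ∀ k, (isom k)ᴴ * isom k = 1
  isom_intertwines : ∀ k g, π.mat g * isom k = isom k * (cls k).rep.mat g
  isom_sum : ∑ k, isom k * (isom k)ᴴ = 1

attribute [instance] IrrepDecomposition.fintypeIndex

end Representations

section CompleteReducibility

variable {G : Type*} [Group G] [TopologicalSpace G]

/-- Every subspace of `ℂⁿ` is the range of an isometry. -/
theorem exists_isometry_onto {n : Type*} [Fintype n] [DecidableEq n] (W : Submodule ℂ (n → ℂ)) :
    ∃ w : Matrix n (Fin (Module.finrank ℂ W)) ℂ, wᴴ * w = 1 ∧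
      (∀ x ∈ W, w *ᵥ (wᴴ *ᵥ x) = x) ∧ ∀ y, w *ᵥ y ∈ W := by
  let e := (WithLp.linearEquiv 2 ℂ (n → ℂ)).symm
  let W' : Submodule ℂ (EuclideanSpace ℂ n) := W.map (e : (n → ℂ) →ₗ[ℂ] EuclideanSpace ℂ n)
  have hd : Module.finrank ℂ W' = Module.finrank ℂ W := LinearEquiv.finrank_map_eq e W
  let b := (stdOrthonormalBasis ℂ W').reindex (finCongr hd)
  have hb : ∀ k, (fun i => (b k : EuclideanSpace ℂ n) i) ∈ W := fun k => by
    obtain ⟨x, hx, hxk⟩ := (b k).2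
    rw [← hxk]
    exact hx
  refine ⟨Matrix.of fun i k => (b k : EuclideanSpace ℂ n) i, ?_, ?_, ?_⟩
  · ext j k
    have := orthonormal_iff_ite.1 b.orthonormal j k
    rw [Submodule.coe_inner, PiLp.inner_apply] at this
    simp only [RCLike.inner_apply] at this
    rw [Matrix.one_apply, ← this, Matrix.mul_apply]
    exact Finset.sum_congr rfl fun i _ => by simp [mul_comm]
  · intro x hx
    have h := b.sum_repr' ⟨e x, ⟨x, hx, rfl⟩⟩
    have h2 := congrArg (fun y : W' => (y : EuclideanSpace ℂ n)) h
    funext i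
    have h3 := congrArg (fun y : EuclideanSpace ℂ n => y i) h2
    simp only [Submodule.coe_sum, Submodule.coe_smul, Submodule.coe_inner] at h3
    have h4 : (e x : EuclideanSpace ℂ n) i = x i := rfl
    rw [h4] at h3
    rw [← h3]
    simp only [WithLp.ofLp_sum, WithLp.ofLp_smul, Finset.sum_apply, Pi.smul_apply, smul_eq_mul,
      Matrix.mulVec, dotProduct, Matrix.of_apply, Matrix.conjTranspose_apply, PiLp.inner_apply,
      RCLike.inner_apply]
    refine Finset.sum_congr rfl fun k _ => ?_
    rw [mul_comm]
    congr 1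
    refine Finset.sum_congr rfl fun j _ => ?_
    rw [mul_comm]
    rfl
  · intro y
    have : (Matrix.of fun i k => (b k : EuclideanSpace ℂ n) i) *ᵥ y =
        ∑ k, y k • (fun i => (b k : EuclideanSpace ℂ n) i) := by
      funext i
      simp [Matrix.mulVec, dotProduct, mul_comm]
    rw [this]
    exact W.sum_mem fun k _ => W.smul_mem _ (hb k)

/-- The restriction of a representation to an invariant subspace, given as the range of an
isometry `w`. -/
def UnitaryRep.compress {n m : Type*} [Fintype n] [DecidableEq n] [Fintype m] [DecidableEq m]
    (π : UnitaryRep G n) (w : Matrix n m ℂ) (hw : wᴴ * w = 1)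
    (hinv : ∀ g, w * wᴴ * (π.mat g * w) = π.mat g * w) : UnitaryRep G m :=
  have hmul : ∀ g h, wᴴ * π.mat (g * h) * w = (wᴴ * π.mat g * w) * (wᴴ * π.mat h * w) := by
    intro g h
    have := hinv h
    simp only [Matrix.mul_assoc] at this ⊢
    rw [this, π.mat_mul, Matrix.mul_assoc]
  have hone : wᴴ * π.mat 1 * w = 1 := by rw [π.mat_one, Matrix.mul_one, hw]
  { toHom :=
      { toFun := fun g => ⟨wᴴ * π.mat g * w, by
          rw [Matrix.mem_unitaryGroup_iff, Matrix.star_eq_conjTranspose,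
            Matrix.conjTranspose_mul, Matrix.conjTranspose_mul, Matrix.conjTranspose_conjTranspose,
            π.conjTranspose_mat, ← Matrix.mul_assoc wᴴ, ← hmul, mul_inv_cancel, hone]⟩
        map_one' := Subtype.ext hone
        map_mul' := fun g h => Subtype.ext (hmul g h) }
    continuous_toHom :=
      (continuous_const.matrix_mul π.continuous_mat).matrix_mul continuous_const }

theorem UnitaryRep.compress_intertwines {n m : Type*} [Fintype n] [DecidableEq n] [Fintype m]
    [DecidableEq m] (π : UnitaryRep G n) (w : Matrix n m ℂ) (hw : wᴴ * w = 1)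
    (hinv : ∀ g, w * wᴴ * (π.mat g * w) = π.mat g * w) (g : G) :
    π.mat g * w = w * (π.compress w hw hinv).mat g := by
  change π.mat g * w = w * (wᴴ * π.mat g * w)
  simpa only [Matrix.mul_assoc] using (hinv g).symm

/-- Decompositions of complementary subrepresentations combine to one of the representation. -/
theorem nonempty_irrepDecomposition_of_sum {n : Type*} [Fintype n] [DecidableEq n]
    {π : UnitaryRep G n} {a b : ℕ} {ρ : UnitaryRep G (Fin a)} {τ : UnitaryRep G (Fin b)}
    (w : Matrix n (Fin a) ℂ) (u : Matrix n (Fin b) ℂ) (hw : wᴴ * w = 1) (hu : uᴴ * u = 1)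
    (hπw : ∀ g, π.mat g * w = w * ρ.mat g) (hπu : ∀ g, π.mat g * u = u * τ.mat g)
    (hsum : w * wᴴ + u * uᴴ = 1)
    (hρ : Nonempty (IrrepDecomposition ρ)) (hτ : Nonempty (IrrepDecomposition τ)) :
    Nonempty (IrrepDecomposition π) := by
  obtain ⟨D⟩ := hρ
  obtain ⟨E⟩ := hτ
  have key : ∀ (c : ℕ) (x : Matrix n (Fin c) ℂ) (K : Type) [Fintype K] (d : K → ℕ)
      (v : ∀ k, Matrix (Fin c) (Fin (d k)) ℂ), ∑ k, v k * (v k)ᴴ = 1 →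
      ∑ k, (x * v k) * (x * v k)ᴴ = x * xᴴ := by
    intro c x K _ d v h
    calc ∑ k, (x * v k) * (x * v k)ᴴ = x * (∑ k, v k * (v k)ᴴ) * xᴴ := by
          rw [Matrix.mul_sum, Matrix.sum_mul]
          simp only [Matrix.conjTranspose_mul, Matrix.mul_assoc]
      _ = x * xᴴ := by rw [h, Matrix.mul_one]
  refine ⟨{
    index := D.index ⊕ E.index
    cls := Sum.elim D.cls E.cls
    isom := fun k => match k with
      | .inl k => w * D.isom k
      | .inr k => u * E.isom k
    isom_isometry := ?_
    isom_intertwines := ?_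
    isom_sum := ?_ }⟩
  · rintro (k | k)
    · change (w * D.isom k)ᴴ * (w * D.isom k) = 1
      rw [Matrix.conjTranspose_mul, Matrix.mul_assoc, ← Matrix.mul_assoc wᴴ, hw, Matrix.one_mul,
        D.isom_isometry]
    · change (u * E.isom k)ᴴ * (u * E.isom k) = 1
      rw [Matrix.conjTranspose_mul, Matrix.mul_assoc, ← Matrix.mul_assoc uᴴ, hu, Matrix.one_mul,
        E.isom_isometry]
  · rintro (k | k) g
    · change π.mat g * (w * D.isom k) = (w * D.isom k) * (D.cls k).rep.mat g
      rw [← Matrix.mul_assoc, hπw, Matrix.mul_assoc, D.isom_intertwines, Matrix.mul_assoc]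
    · change π.mat g * (u * E.isom k) = (u * E.isom k) * (E.cls k).rep.mat g
      rw [← Matrix.mul_assoc, hπu, Matrix.mul_assoc, E.isom_intertwines, Matrix.mul_assoc]
  · rw [Fintype.sum_sum_type, ← hsum, ← key a w D.index _ D.isom D.isom_sum,
      ← key b u E.index _ E.isom E.isom_sum]
    rfl

theorem nonempty_irrepDecomposition_of_isIrreducible {d : ℕ} (π : UnitaryRep G (Fin d))
    (hπ : π.IsIrreducible) : Nonempty (IrrepDecomposition π) := by
  let p : IrrepObj G := ⟨⟨d, π⟩, hπ⟩
  let σ : UnitaryDual G := Quotient.mk _ p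
  have h : σ.rep.Equivalent π := Quotient.exact (Quotient.out_eq σ)
  obtain ⟨u, h1, h2, h3⟩ := h
  exact ⟨{
    index := Unit
    cls := fun _ => σ
    isom := fun _ => u
    isom_isometry := fun _ => h1
    isom_intertwines := fun _ g => (h3 g).symm
    isom_sum := by simpa using h2 }⟩

/-- Complete reducibility, for representations on `ℂᵈ`. -/
theorem nonempty_irrepDecomposition_fin (d : ℕ) :
    ∀ π : UnitaryRep G (Fin d), Nonempty (IrrepDecomposition π) := by
  induction d using Nat.strong_induction_on with
  | _ d ih =>
  intro π
  rcases Nat.eq_zero_or_pos d with rfl | hd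
  · exact ⟨{
      index := Empty
      cls := fun k => k.elim
      isom := fun k => k.elim
      isom_isometry := fun k => k.elim
      isom_intertwines := fun k => k.elim
      isom_sum := Subsingleton.elim _ _ }⟩
  by_cases hπ : π.IsIrreducible
  · exact nonempty_irrepDecomposition_of_isIrreducible π hπ
  have : ∃ W : Submodule ℂ (Fin d → ℂ), (∀ g, ∀ x ∈ W, π.mat g *ᵥ x ∈ W) ∧ W ≠ ⊥ ∧ W ≠ ⊤ := by
    by_contra hcon
    push Not at hcon
    apply hπ
    have : Nonempty (Fin d) := ⟨⟨0, hd⟩⟩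
    have : Nontrivial (Subrepresentation π.toRepresentation) := by
      refine ⟨⟨⟨⊥, fun g v hv => ?_⟩, ⟨⊤, fun _ _ _ => trivial⟩, fun h => ?_⟩⟩
      · rw [Submodule.mem_bot] at hv ⊢
        rw [hv, map_zero]
      · have := congrArg Subrepresentation.toSubmodule h
        exact bot_ne_top this
    refine IsSimpleOrder.mk fun S => ?_
    by_cases hS : S.toSubmodule = ⊥
    · left
      exact Subrepresentation.toSubmodule_injective hS
    · right
      refine Subrepresentation.toSubmodule_injective (hcon S.toSubmodule (fun g x hx => ?_) hS)
      have := S.apply_mem_toSubmodule g hx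
      simpa [UnitaryRep.toRepresentation] using this
  obtain ⟨W, hW, hbot, htop⟩ := this
  obtain ⟨w, hw1, hw2, hw3⟩ := exists_isometry_onto W
  obtain ⟨u, hu1, hu2, hu3⟩ := exists_isometry_onto (LinearMap.ker (Matrix.toLin' wᴴ))
  have hwinv : ∀ g, w * wᴴ * (π.mat g * w) = π.mat g * w := fun g => by
    refine Matrix.toLin'.injective (LinearMap.ext fun y => ?_)
    simp only [Matrix.toLin'_apply, ← Matrix.mulVec_mulVec]
    exact hw2 _ (hW g _ (hw3 y))
  have hwu : wᴴ * u = 0 := by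
    refine Matrix.toLin'.injective (LinearMap.ext fun y => ?_)
    have := hu3 y
    rw [LinearMap.mem_ker, Matrix.toLin'_apply, Matrix.mulVec_mulVec] at this
    simpa using this
  have huw : uᴴ * w = 0 := by
    have := congrArg Matrix.conjTranspose hwu
    simpa using this
  have hsum : w * wᴴ + u * uᴴ = 1 := by
    have h1 : u * uᴴ * (1 - w * wᴴ) = 1 - w * wᴴ := by
      refine Matrix.toLin'.injective (LinearMap.ext fun y => ?_)
      simp only [Matrix.toLin'_apply, ← Matrix.mulVec_mulVec]
      refine hu2 _ ?_
      rw [LinearMap.mem_ker, Matrix.toLin'_apply, Matrix.mulVec_mulVec, Matrix.mul_sub,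
        Matrix.mul_one, ← Matrix.mul_assoc, hw1, Matrix.one_mul, sub_self, Matrix.zero_mulVec]
    have h2 : u * uᴴ * (w * wᴴ) = 0 := by
      rw [Matrix.mul_assoc, ← Matrix.mul_assoc uᴴ, huw, Matrix.zero_mul, Matrix.mul_zero]
    rw [Matrix.mul_sub, Matrix.mul_one, h2, sub_zero] at h1
    rw [h1]
    abel
  have hcomm : ∀ g, w * wᴴ * π.mat g = π.mat g * (w * wᴴ) := fun g => by
    have h1 : w * wᴴ * π.mat g * (w * wᴴ) = π.mat g * (w * wᴴ) := by
      have := congrArg (· * wᴴ) (hwinv g)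
      simpa only [Matrix.mul_assoc] using this
    have h2 : w * wᴴ * π.mat g * (w * wᴴ) = w * wᴴ * π.mat g := by
      have h3 := congrArg (· * wᴴ) (hwinv g⁻¹)
      have := congrArg Matrix.conjTranspose h3
      simpa only [Matrix.conjTranspose_mul, Matrix.conjTranspose_conjTranspose, Matrix.mul_assoc,
        UnitaryRep.conjTranspose_mat, inv_inv] using this
    exact h2.symm.trans h1
  have huinv : ∀ g, u * uᴴ * (π.mat g * u) = π.mat g * u := fun g => by
    have h1 : u * uᴴ = 1 - w * wᴴ := by rw [← hsum]; abel
    rw [h1, Matrix.sub_mul, Matrix.one_mul, ← Matrix.mul_assoc (w * wᴴ), hcomm,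
      Matrix.mul_assoc (π.mat g), Matrix.mul_assoc w, hwu, Matrix.mul_zero, Matrix.mul_zero,
      sub_zero]
  have ha : Module.finrank ℂ W < d := by
    have := Submodule.finrank_lt htop
    simpa using this
  have hb : Module.finrank ℂ (LinearMap.ker (Matrix.toLin' wᴴ)) < d := by
    have hne : LinearMap.ker (Matrix.toLin' wᴴ) ≠ ⊤ := fun h => by
      apply hbot
      rw [Submodule.eq_bot_iff]
      intro x hx
      have h1 : x ∈ LinearMap.ker (Matrix.toLin' wᴴ) := by rw [h]; trivial
      rw [LinearMap.mem_ker, Matrix.toLin'_apply] at h1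
      rw [← hw2 x hx, h1, Matrix.mulVec_zero]
    have := Submodule.finrank_lt hne
    simpa using this
  exact nonempty_irrepDecomposition_of_sum w u hw1 hu1
    (π.compress_intertwines w hw1 hwinv) (π.compress_intertwines u hu1 huinv) hsum
    (ih _ ha _) (ih _ hb _)

/-- Complete reducibility. -/
theorem nonempty_irrepDecomposition {n : Type*} [Fintype n] [DecidableEq n]
    (π : UnitaryRep G n) : Nonempty (IrrepDecomposition π) := by
  let e := Fintype.equivFin n
  let w : Matrix n (Fin (Fintype.card n)) ℂ := (1 : Matrix n n ℂ).submatrix id e.symm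
  have hw : wᴴ * w = 1 := by
    ext i j
    simp [w, Matrix.mul_apply, Matrix.one_apply]
  have hw' : w * wᴴ = 1 := by
    ext i j
    rw [Matrix.mul_apply, ← e.sum_comp]
    simp [w, Matrix.one_apply]
  have hinv : ∀ g, w * wᴴ * (π.mat g * w) = π.mat g * w := fun g => by
    rw [hw', Matrix.one_mul]
  let z : UnitaryRep G (Fin 0) := ⟨1, continuous_const⟩
  refine nonempty_irrepDecomposition_of_sum w (0 : Matrix n (Fin 0) ℂ) hw
    (Subsingleton.elim _ _) (τ := z) (π.compress_intertwines w hw hinv)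
    (fun g => ?_) ?_ (nonempty_irrepDecomposition_fin _ _) (nonempty_irrepDecomposition_fin _ _)
  · simp
  · simp [hw']

end CompleteReducibility

section FactorSystems

/-- The extension of a family `x_σ ∈ A ⊗ End(V_σ)`, `σ ∈ Ĝ`, to an arbitrary representation `π`:
`x_π = ∑ₖ vₖ x_{σₖ} vₖ*` for a decomposition of `π` with isometric intertwiners `vₖ : V_{σₖ} → V_π`.
The result does not depend on the decomposition. -/
noncomputable def extendFamily {G : Type*} [Group G] [TopologicalSpace G]
    {A : Type*} [Ring A] [Algebra ℂ A] (x : ∀ σ : UnitaryDual G, Matrix (Fin σ.dim) (Fin σ.dim) A)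
    {n : Type*} [Fintype n] [DecidableEq n] (π : UnitaryRep G n) : Matrix n n A :=
  let D := (nonempty_irrepDecomposition π).some
  ∑ k, (D.isom k).map (algebraMap ℂ A) * x (D.cls k) * ((D.isom k)ᴴ).map (algebraMap ℂ A)

/-- A C*-dynamical system `(A, G, α)` whose fixed point algebra is `B`: the injective unital
*-homomorphism `incl : B → A` identifies `B` with the algebra of all fixed points of `α`. -/
structure CStarSystem (G : Type*) [Group G] [TopologicalSpace G]
    (A : Type*) [CStarAlgebra A] (B : Type*) [CStarAlgebra B] where
  act : G →* (A ≃⋆ₐ[ℂ] A)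
  continuous_act : ∀ a : A, Continuous fun g => act g a
  incl : B →⋆ₐ[ℂ] A
  incl_injective : Function.Injective incl
  range_incl : Set.range incl = {a : A | ∀ g, act g a = a}

namespace CStarSystem

variable {G : Type*} [Group G] [TopologicalSpace G]
variable {A : Type*} [CStarAlgebra A] {A' : Type*} [CStarAlgebra A'] {B : Type*} [CStarAlgebra B]

/-- The generalized isotypic component
`A₂(π) = {x ∈ A ⊗ End(V) | π_g · α_g(x) = x for all g ∈ G}`. -/
def genIsotypic (S : CStarSystem G A B) {n : Type*} [Fintype n] [DecidableEq n]
    (π : UnitaryRep G n) : Set (Matrix n n A) :=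
  {x | ∀ g, (π.mat g).map (algebraMap ℂ A) * x.map (S.act g) = x}

/-- Non-degenerate isometries in `A₂(π)`. -/
def IsNondegIsometry (S : CStarSystem G A B) {n : Type*} [Fintype n] [DecidableEq n]
    (π : UnitaryRep G n) (s : Matrix n n A) : Prop :=
  s ∈ S.genIsotypic π ∧ sᴴ * s = 1 ∧ ∀ x ∈ S.genIsotypic π, s * sᴴ * x = x

/-- Weakly cleft systems. -/
def IsWeaklyCleft (S : CStarSystem G A B) : Prop :=
  ∀ (d : ℕ) (π : UnitaryRep G (Fin d)), π.IsIrreducible → ∃ s, S.IsNondegIsometry π s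

/-- Equivalence of two systems with the same fixed point algebra `B`: a `G`-equivariant
*-isomorphism that restricts to the identity of `B`. -/
def Equivalent (S : CStarSystem G A B) (S' : CStarSystem G A' B) : Prop :=
  ∃ φ : A ≃⋆ₐ[ℂ] A', (∀ g a, φ (S.act g a) = S'.act g (φ a)) ∧ ∀ b, φ (S.incl b) = S'.incl b

end CStarSystem

/-- The data `(γ, ω)` of a factor system: maps `γ_σ : B → B ⊗ End(V_σ)` and elements
`ω(σ, τ) ∈ B ⊗ End(V_σ ⊗ V_τ)`, for `σ, τ ∈ Ĝ`. -/
structure FactorData (G : Type*) [Group G] [TopologicalSpace G]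
    (B : Type*) [CStarAlgebra B] where
  γ : ∀ σ : UnitaryDual G, B → Matrix (Fin σ.dim) (Fin σ.dim) B
  ω : ∀ σ τ : UnitaryDual G, Matrix (Fin σ.dim × Fin τ.dim) (Fin σ.dim × Fin τ.dim) B

namespace FactorData

variable {G : Type*} [Group G] [TopologicalSpace G]
variable {A : Type*} [CStarAlgebra A] {B : Type*} [CStarAlgebra B]

/-- `(γ, ω)` is the factor system arising from a family of non-degenerate isometries
`s_σ ∈ A₂(σ)`, `σ ∈ Ĝ`, with `s_1 = 1`, that is
`γ_σ(b) = s_σ* (b ⊗ 1) s_σ` and `ω(σ, τ) = s_{σ ⊗ τ}* (s_σ)₁₂ (s_τ)₁₃`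
(as elements of `A ⊗ End(V_σ)` and `A ⊗ End(V_σ) ⊗ End(V_τ)`, with `B` regarded as a subalgebra
of `A`). -/
def IsAssociatedVia (F : FactorData G B) (S : CStarSystem G A B)
    (s : ∀ σ : UnitaryDual G, Matrix (Fin σ.dim) (Fin σ.dim) A) : Prop :=
  (∀ σ, S.IsNondegIsometry σ.rep (s σ)) ∧
  (∀ σ : UnitaryDual G, (∀ g, σ.rep.mat g = 1) → s σ = 1) ∧
  (∀ σ b, (F.γ σ b).map S.incl = (s σ)ᴴ * Matrix.scalar (Fin σ.dim) (S.incl b) * s σ) ∧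
  ∀ σ τ, (F.ω σ τ).map S.incl =
    (extendFamily s (σ.rep.tensor τ.rep))ᴴ * (s σ ⊗ₖ 1) * (1 ⊗ₖ s τ)

/-- `(γ, ω)` is a factor system associated with the system `S`. -/
def IsAssociated (F : FactorData G B) (S : CStarSystem G A B) : Prop :=
  ∃ s : ∀ σ : UnitaryDual G, Matrix (Fin σ.dim) (Fin σ.dim) A, F.IsAssociatedVia S s

/-- The amplification `id_σ ⊗ γ_τ : B ⊗ End(V_σ) → B ⊗ End(V_σ) ⊗ End(V_τ)`. -/
def ampl (F : FactorData G B) (τ : UnitaryDual G) {n : Type*} (x : Matrix n n B) :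
    Matrix (n × Fin τ.dim) (n × Fin τ.dim) B :=
  Matrix.of fun i j => F.γ τ (x i.1 j.1) i.2 j.2

/-- Conjugacy of `(γ, ω)` and `(γ', ω')`: there are unitaries `v_σ ∈ B ⊗ End(V_σ)` with
`γ'_σ = Ad[v_σ*] ∘ γ_σ` and `v_{σ ⊗ τ} ω'(σ, τ) = ω(σ, τ) (id_σ ⊗ γ_τ)(v_σ) (v_τ)₁₃`. -/
def Conjugated (F F' : FactorData G B) : Prop :=
  ∃ v : ∀ σ : UnitaryDual G, Matrix (Fin σ.dim) (Fin σ.dim) B,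
    (∀ σ, (v σ)ᴴ * v σ = 1 ∧ v σ * (v σ)ᴴ = 1) ∧
    (∀ σ b, F'.γ σ b = (v σ)ᴴ * F.γ σ b * v σ) ∧
    ∀ σ τ, extendFamily v (σ.rep.tensor τ.rep) * F'.ω σ τ =
      F.ω σ τ * F.ampl τ (v σ) * (1 ⊗ₖ v τ)

end FactorData

end FactorSystems

/-!
Suppose that `(γ', ω')` arises from `(γ, ω)` by the unitaries `v_σ`. If `s` is the family of
isometries of the first system that gives `(γ, ω)`, then `σ ↦ s_σ v_σ` gives `(γ', ω')`
(`FactorData.IsAssociatedVia.of_conjugacy`), where the normalization `v_1 = 1` is forced by the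
cocycle relation. Conversely, two families `s`, `t` of the same system are related by the unitaries
`v_σ = s_σ* t_σ`, which conjugate the factor systems (`FactorData.IsAssociatedVia.conjugated`). As
factor systems are transported by equivalences of systems, the theorem is reduced to the statement
that systems with a common factor system are equivalent (`FactorData.IsAssociatedVia.equivalent`).

For this, let `s` and `s'` be families of the two systems with the same `(γ, ω)`, and let `Γ` be the
span in `A × A'` of the pairs of corresponding entries of `s_σ y` and `s'_σ y`, for `σ ∈ Ĝ` and
`y ∈ B ⊗ End(V_σ)`. It is closed under products, since `(s_σ y) ⊗ (s_τ z)` equals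
`s_{σ ⊗ τ} ω(σ, τ) (id ⊗ γ_τ)(y) (1 ⊗ z)`, and under adjoints, since the conjugate of `s_σ` can be
expressed by `ω` (`FactorData.IsAssociatedVia.map_mul_map_star`). The average over the group maps
both components of an element of `Γ` to the same element of `B`, and it is a faithful positive map
that determines norms by `‖a*a‖ = lim ‖E((a*a)ⁿ)‖^{1/n}` (`norm_le_of_forall_norm_map_pow_le`). So
`‖a‖ = ‖a'‖` for `(a, a') ∈ Γ`; no separate proof that `Γ` is the graph of a map is needed.

Since `s_σ s_σ* x = x` for isotypic `x`, the projections of `Γ` contain the isotypic components, the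
sum of which is dense. This is the Peter–Weyl theorem, obtained here from the spectral theorem for
the compact operators `T* T`, where `T` maps to matrix coefficients
(`eq_zero_of_orthogonal_finiteDimensional`), and transferred from `L²(G)` to `A` by the smearing maps
`f ↦ ∫ f(g) α_g(a) dg`. Hence the closure of `Γ` is the graph of a *-isomorphism, which is equivariant
and the identity on `B`.
-/

/-! ### Matrices over a complex algebra -/

section ScalarMatrices

variable {A : Type*} [Ring A] [Algebra ℂ A]

theorem Matrix.map_mul_of_hom {R S F : Type*} [NonAssocSemiring R] [NonAssocSemiring S]
    [FunLike F R S] [RingHomClass F R S] (f : F) {l m n : Type*} [Fintype m]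
    (x : Matrix l m R) (y : Matrix m n R) : (x * y).map f = x.map f * y.map f := by
  ext i j
  simp [Matrix.mul_apply]

theorem Matrix.map_conjTranspose_of_hom {R S F : Type*} [Star R] [Star S]
    [FunLike F R S] [StarHomClass F R S] (f : F) {m n : Type*}
    (x : Matrix m n R) : xᴴ.map f = (x.map f)ᴴ := by
  ext i j
  simp [map_star]

theorem Matrix.map_scalar_of_hom {R S F : Type*} [Semiring R] [Semiring S] [Algebra ℂ R]
    [Algebra ℂ S] [FunLike F R S] [AlgHomClass F ℂ R S] (f : F) {m n : Type*}
    (M : Matrix m n ℂ) : (M.map (algebraMap ℂ R)).map f = M.map (algebraMap ℂ S) := by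
  ext i j
  exact AlgHomClass.commutes f (M i j)

theorem Matrix.map_scalar_conjTranspose [StarRing A] [StarModule ℂ A] {m n : Type*}
    (M : Matrix m n ℂ) : (M.map (algebraMap ℂ A))ᴴ = Mᴴ.map (algebraMap ℂ A) := by
  ext i j
  simp only [Matrix.conjTranspose_apply, Matrix.map_apply, algebraMap_star_comm]

theorem Matrix.kronecker_eq_mul {R : Type*} [Semiring R] {l m n p : Type*} [Fintype m] [Fintype n]
    [DecidableEq m] [DecidableEq n] (x : Matrix l m R) (y : Matrix n p R) :
    (x ⊗ₖ (1 : Matrix n n R)) * ((1 : Matrix m m R) ⊗ₖ y) = x ⊗ₖ y := by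
  ext ⟨i, k⟩ ⟨j, l⟩
  simp [Matrix.mul_apply, Matrix.one_apply, Fintype.sum_prod_type, mul_ite]

theorem Matrix.mul_kronecker_one {R : Type*} [Semiring R] {l m n p : Type*} [Fintype m]
    [Fintype p] [DecidableEq p]
    (x : Matrix l m R) (y : Matrix m n R) :
    (x * y) ⊗ₖ (1 : Matrix p p R) = (x ⊗ₖ (1 : Matrix p p R)) * (y ⊗ₖ (1 : Matrix p p R)) := by
  ext ⟨i, k⟩ ⟨j, l⟩
  simp [Matrix.mul_apply, Matrix.one_apply, Fintype.sum_prod_type]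

theorem Matrix.one_kronecker_mul {R : Type*} [Semiring R] {l m n p : Type*} [Fintype m]
    [Fintype p] [DecidableEq p]
    (x : Matrix l m R) (y : Matrix m n R) :
    (1 : Matrix p p R) ⊗ₖ (x * y) = ((1 : Matrix p p R) ⊗ₖ x) * ((1 : Matrix p p R) ⊗ₖ y) := by
  ext ⟨i, k⟩ ⟨j, l⟩
  simp [Matrix.mul_apply, Matrix.one_apply, Fintype.sum_prod_type, ite_mul]

theorem Matrix.scalar_kronecker_mul {l m n l' m' n' : Type*} [Fintype m] [Fintype m']
    (M : Matrix l m ℂ) (N : Matrix l' m' ℂ) (x : Matrix m n A) (y : Matrix m' n' A) :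
    (M ⊗ₖ N).map (algebraMap ℂ A) * (x ⊗ₖ y) =
      (M.map (algebraMap ℂ A) * x) ⊗ₖ (N.map (algebraMap ℂ A) * y) := by
  ext ⟨i, k⟩ ⟨j, l⟩
  simp only [Matrix.mul_apply, Matrix.map_apply, Matrix.kroneckerMap_apply, Fintype.sum_prod_type,
    Finset.sum_mul_sum, map_mul]
  refine Finset.sum_congr rfl fun a _ => Finset.sum_congr rfl fun b _ => ?_
  rw [mul_assoc, mul_assoc, ← mul_assoc _ (x a j), Algebra.commutes (N k b) (x a j), mul_assoc]

theorem Matrix.map_scalar_mul_scalar {m n : Type*} [Fintype m] [DecidableEq m] [Fintype n]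
    [DecidableEq n] (M : Matrix m n ℂ) (b : A) :
    M.map (algebraMap ℂ A) * Matrix.scalar n b = Matrix.scalar m b * M.map (algebraMap ℂ A) := by
  ext i j
  simp [Algebra.commutes]

end ScalarMatrices

/-! ### Extension of families to arbitrary representations -/

section Extension

variable {G : Type*} [Group G] [TopologicalSpace G] {n : Type*} [Fintype n] [DecidableEq n]

/-- The decomposition of `π` into irreducible representations used by `extendFamily`. -/
noncomputable def UnitaryRep.decomposition (π : UnitaryRep G n) : IrrepDecomposition π :=
  (nonempty_irrepDecomposition π).some

theorem extendFamily_eq {A : Type*} [Ring A] [Algebra ℂ A]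
    (x : ∀ σ : UnitaryDual G, Matrix (Fin σ.dim) (Fin σ.dim) A) (π : UnitaryRep G n) :
    extendFamily x π = ∑ k, (π.decomposition.isom k).map (algebraMap ℂ A) *
      x (π.decomposition.cls k) * ((π.decomposition.isom k)ᴴ).map (algebraMap ℂ A) := rfl

theorem UnitaryDual.isIrreducible_rep (σ : UnitaryDual G) : σ.rep.IsIrreducible :=
  (Quotient.out σ).2

open scoped ComplexOrder in
/-- Distinct summands are orthogonal, as `∑ₗ vₖ*vₗ(vₖ*vₗ)* = vₖ*vₖ = 1` and the term `l = k` of this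
sum of positive matrices is already `1`. -/
theorem IrrepDecomposition.isom_orthogonal {π : UnitaryRep G n} (D : IrrepDecomposition π)
    {k l : D.index} (h : k ≠ l) : (D.isom k)ᴴ * D.isom l = 0 := by
  classical
  have h1 : ∑ j, ((D.isom k)ᴴ * D.isom j) * ((D.isom k)ᴴ * D.isom j)ᴴ = 1 := by
    calc ∑ j, ((D.isom k)ᴴ * D.isom j) * ((D.isom k)ᴴ * D.isom j)ᴴ
        = (D.isom k)ᴴ * (∑ j, D.isom j * (D.isom j)ᴴ) * D.isom k := by
          rw [Matrix.mul_sum, Matrix.sum_mul]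
          simp only [Matrix.conjTranspose_mul, Matrix.conjTranspose_conjTranspose, Matrix.mul_assoc]
      _ = 1 := by rw [D.isom_sum, Matrix.mul_one, D.isom_isometry]
  rw [← Finset.add_sum_erase _ _ (Finset.mem_univ k), D.isom_isometry, Matrix.conjTranspose_one,
    Matrix.mul_one, add_eq_left] at h1
  have h2 := congrArg Matrix.trace h1
  rw [Matrix.trace_sum, Matrix.trace_zero] at h2
  have h3 := (Finset.sum_eq_zero_iff_of_nonneg fun j _ => by
    exact (Matrix.posSemidef_self_mul_conjTranspose _).trace_nonneg).1 h2 l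
      (Finset.mem_erase.2 ⟨h.symm, Finset.mem_univ l⟩)
  exact Matrix.trace_mul_conjTranspose_self_eq_zero_iff.1 h3

theorem IrrepDecomposition.conjTranspose_isom_intertwines {π : UnitaryRep G n}
    (D : IrrepDecomposition π) (k : D.index) (g : G) :
    (D.isom k)ᴴ * π.mat g = (D.cls k).rep.mat g * (D.isom k)ᴴ := by
  have := congrArg Matrix.conjTranspose (D.isom_intertwines k g⁻¹)
  simpa only [Matrix.conjTranspose_mul, UnitaryRep.conjTranspose_mat, inv_inv] using this

theorem IrrepDecomposition.sum_map_isom {A : Type*} [Ring A] [Algebra ℂ A]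
    {π : UnitaryRep G n} (D : IrrepDecomposition π) {m : Type*} (x : Matrix n m A) :
    ∑ k, (D.isom k).map (algebraMap ℂ A) * (((D.isom k)ᴴ).map (algebraMap ℂ A) * x) = x := by
  simp_rw [← Matrix.mul_assoc, ← Matrix.map_mul_of_hom]
  rw [← Matrix.sum_mul]
  have : ∑ k, (D.isom k * (D.isom k)ᴴ).map (algebraMap ℂ A) = 1 := by
    have h := congrArg (fun M : Matrix n n ℂ => M.map (algebraMap ℂ A)) D.isom_sum
    rw [Matrix.map_one _ (map_zero _) (map_one _)] at h
    rw [← h]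
    ext i j
    simp only [Matrix.sum_apply, Matrix.map_apply, map_sum]
  rw [this, Matrix.one_mul]

theorem IrrepDecomposition.map_isom_isometry {A : Type*} [Ring A] [Algebra ℂ A]
    {π : UnitaryRep G n} (D : IrrepDecomposition π) (k : D.index) :
    ((D.isom k)ᴴ).map (algebraMap ℂ A) * (D.isom k).map (algebraMap ℂ A) = 1 := by
  rw [← Matrix.map_mul_of_hom, D.isom_isometry, Matrix.map_one _ (map_zero _) (map_one _)]

theorem IrrepDecomposition.map_isom_orthogonal {A : Type*} [Ring A] [Algebra ℂ A]
    {π : UnitaryRep G n} (D : IrrepDecomposition π) {k l : D.index} (h : k ≠ l) :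
    ((D.isom k)ᴴ).map (algebraMap ℂ A) * (D.isom l).map (algebraMap ℂ A) = 0 := by
  rw [← Matrix.map_mul_of_hom, D.isom_orthogonal h, Matrix.map_zero _ (map_zero _)]

variable {A : Type*} [Ring A] [Algebra ℂ A]

theorem extendFamily_mul (x y : ∀ σ : UnitaryDual G, Matrix (Fin σ.dim) (Fin σ.dim) A)
    (π : UnitaryRep G n) :
    extendFamily (fun σ => x σ * y σ) π = extendFamily x π * extendFamily y π := by
  classical
  simp only [extendFamily_eq]
  generalize π.decomposition = D
  rw [Matrix.sum_mul]
  refine Finset.sum_congr rfl fun k _ => ?_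
  rw [Matrix.mul_sum, Finset.sum_eq_single k]
  · simp only [Matrix.mul_assoc]
    rw [← Matrix.mul_assoc (((D.isom k)ᴴ).map (algebraMap ℂ A)) ((D.isom k).map _),
      D.map_isom_isometry, Matrix.one_mul]
  · intro l _ hl
    simp only [Matrix.mul_assoc]
    rw [← Matrix.mul_assoc (((D.isom k)ᴴ).map (algebraMap ℂ A)) ((D.isom l).map _),
      D.map_isom_orthogonal hl.symm, Matrix.zero_mul, Matrix.mul_zero, Matrix.mul_zero]
  · simp

theorem extendFamily_one (π : UnitaryRep G n) :
    extendFamily (fun _ => (1 : Matrix _ _ A)) π = 1 := by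
  simpa only [extendFamily_eq, Matrix.mul_one, Matrix.mul_assoc] using
    π.decomposition.sum_map_isom (1 : Matrix n n A)

theorem extendFamily_conjTranspose [StarRing A] [StarModule ℂ A]
    (x : ∀ σ : UnitaryDual G, Matrix (Fin σ.dim) (Fin σ.dim) A) (π : UnitaryRep G n) :
    (extendFamily x π)ᴴ = extendFamily (fun σ => (x σ)ᴴ) π := by
  simp only [extendFamily_eq, Matrix.conjTranspose_sum, Matrix.conjTranspose_mul,
    Matrix.map_scalar_conjTranspose, Matrix.conjTranspose_conjTranspose, Matrix.mul_assoc]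

theorem extendFamily_map {C F : Type*} [Ring C] [Algebra ℂ C] [FunLike F A C]
    [AlgHomClass F ℂ A C] (f : F)
    (x : ∀ σ : UnitaryDual G, Matrix (Fin σ.dim) (Fin σ.dim) A) (π : UnitaryRep G n) :
    (extendFamily x π).map f = extendFamily (fun σ => (x σ).map f) π := by
  simp only [extendFamily_eq, ← Matrix.map_scalar_of_hom f, ← Matrix.map_mul_of_hom]
  ext i j
  simp only [Matrix.map_apply, Matrix.sum_apply, map_sum]

end Extension

/-! ### Rectangular isotypic matrices -/

namespace CStarSystem

variable {G : Type*} [Group G] [TopologicalSpace G]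
variable {A : Type*} [CStarAlgebra A] {B : Type*} [CStarAlgebra B]
variable {m n l p : Type*} [Fintype n] [DecidableEq n] [Fintype m] [DecidableEq m]

/-- The rectangular version of `genIsotypic`: `x ∈ A ⊗ Hom(ℂᵐ, V_π)` with `π_g · α_g(x) = x` for all
`g`. For square `x` this is membership in `A₂(π)`; for a single column it says that the entries of
`x` span a `G`-invariant subspace on which `G` acts by the conjugate of `π`. -/
def IsIsotypic (S : CStarSystem G A B) (π : UnitaryRep G n) (x : Matrix n l A) : Prop :=
  ∀ g, (π.mat g).map (algebraMap ℂ A) * x.map (S.act g) = x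

/-- Matrices whose entries are fixed points of the action. -/
def IsFixed (S : CStarSystem G A B) (y : Matrix l p A) : Prop :=
  ∀ g, y.map (S.act g) = y

variable {S : CStarSystem G A B} {π : UnitaryRep G n} {ρ : UnitaryRep G m}

theorem isFixed_map_incl (y : Matrix l p B) : S.IsFixed (y.map S.incl) := by
  intro g
  ext i j
  have : S.incl (y i j) ∈ Set.range S.incl := ⟨_, rfl⟩
  rw [S.range_incl] at this
  exact this g

theorem IsFixed.exists_map_incl {y : Matrix l p A} (hy : S.IsFixed y) :
    ∃ b : Matrix l p B, b.map S.incl = y := by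
  have h : ∀ i j, ∃ b, S.incl b = y i j := fun i j => by
    have : y i j ∈ Set.range S.incl := by
      rw [S.range_incl]
      exact fun g => congrFun (congrFun (hy g) i) j
    exact this
  choose b hb using h
  exact ⟨Matrix.of b, by ext i j; exact hb i j⟩

theorem map_incl_injective (S : CStarSystem G A B) :
    Function.Injective fun y : Matrix l p B => y.map S.incl := by
  intro y z h
  ext i j
  exact S.incl_injective (congrFun (congrFun h i) j)

theorem map_mat_mul_map_mat_inv (π : UnitaryRep G n) (g : G) :
    (π.mat g).map (algebraMap ℂ A) * (π.mat g⁻¹).map (algebraMap ℂ A) = 1 := by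
  rw [← Matrix.map_mul_of_hom, ← π.mat_mul, mul_inv_cancel, π.mat_one,
    Matrix.map_one _ (map_zero _) (map_one _)]

theorem isIsotypic_iff {x : Matrix n l A} :
    S.IsIsotypic π x ↔ ∀ g, x.map (S.act g) = (π.mat g⁻¹).map (algebraMap ℂ A) * x := by
  constructor
  · intro h g
    have h1 := map_mat_mul_map_mat_inv (A := A) π g⁻¹
    rw [inv_inv] at h1
    conv_rhs => rw [← h g]
    rw [← Matrix.mul_assoc, h1, Matrix.one_mul]
  · intro h g
    rw [h, ← Matrix.mul_assoc, map_mat_mul_map_mat_inv, Matrix.one_mul]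

theorem IsIsotypic.mul [Fintype l] {x : Matrix n l A} {y : Matrix l p A} (hx : S.IsIsotypic π x)
    (hy : S.IsFixed y) : S.IsIsotypic π (x * y) := fun g => by
  rw [Matrix.map_mul_of_hom, hy g, ← Matrix.mul_assoc, hx g]

theorem IsIsotypic.intertwine {x : Matrix n l A} (hx : S.IsIsotypic π x) {u : Matrix m n ℂ}
    (hu : ∀ g, u * π.mat g = ρ.mat g * u) :
    S.IsIsotypic ρ (u.map (algebraMap ℂ A) * x) := fun g => by
  rw [Matrix.map_mul_of_hom, Matrix.map_scalar_of_hom, ← Matrix.mul_assoc,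
    ← Matrix.map_mul_of_hom, ← hu, Matrix.map_mul_of_hom, Matrix.mul_assoc, hx g]

theorem IsIsotypic.conjTranspose_mul {x : Matrix n l A} {y : Matrix n p A}
    (hx : S.IsIsotypic π x) (hy : S.IsIsotypic π y) : S.IsFixed (xᴴ * y) := fun g => by
  rw [isIsotypic_iff] at hx hy
  rw [Matrix.map_mul_of_hom, Matrix.map_conjTranspose_of_hom, hx, hy, Matrix.conjTranspose_mul,
    Matrix.map_scalar_conjTranspose, π.conjTranspose_mat, inv_inv, Matrix.mul_assoc,
    ← Matrix.mul_assoc (Matrix.map _ _), map_mat_mul_map_mat_inv, Matrix.one_mul]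

theorem IsIsotypic.fixed_smul {x : Matrix n l A} (hx : S.IsIsotypic π x) {b : A}
    (hb : ∀ g, S.act g b = b) : S.IsIsotypic π (Matrix.scalar n b * x) := fun g => by
  rw [Matrix.map_mul_of_hom]
  have h1 : (Matrix.scalar n b).map (S.act g) = Matrix.scalar n b := by
    ext i j
    by_cases h : i = j <;> simp [h, hb]
  rw [h1, ← Matrix.mul_assoc, Matrix.map_scalar_mul_scalar, Matrix.mul_assoc, hx g]

theorem IsIsotypic.kronecker {x : Matrix n l A} {y : Matrix m p A}
    (hx : S.IsIsotypic π x) (hy : S.IsIsotypic ρ y) :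
    S.IsIsotypic (π.tensor ρ) (x ⊗ₖ y) := fun g => by
  have h : (x ⊗ₖ y).map (S.act g) = x.map (S.act g) ⊗ₖ y.map (S.act g) := by
    ext i j
    simp
  rw [h, show (π.tensor ρ).mat g = π.mat g ⊗ₖ ρ.mat g from rfl, Matrix.scalar_kronecker_mul, hx g,
    hy g]

/-- The columns of `x`, repeated to form square matrices, lie in `A₂(π)`, so that the
non-degeneracy of `s` applies to rectangular `x` as well. -/
theorem IsNondegIsometry.mul_conjTranspose_mul {s : Matrix n n A} (hs : S.IsNondegIsometry π s)
    {x : Matrix n l A} (hx : S.IsIsotypic π x) : s * (sᴴ * x) = x := by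
  ext i j
  have h1 : (Matrix.of fun a (_ : n) => x a j) ∈ S.genIsotypic π := fun g => by
    ext a b
    have := congrFun (congrFun (hx g) a) j
    simpa [Matrix.mul_apply] using this
  have h2 := congrFun (congrFun (hs.2.2 _ h1) i) i
  rw [← Matrix.mul_assoc]
  simpa [Matrix.mul_apply] using h2

theorem IsNondegIsometry.isIsotypic {s : Matrix n n A} (hs : S.IsNondegIsometry π s) :
    S.IsIsotypic π s := hs.1

theorem IsIsotypic.extendFamily {s : ∀ σ : UnitaryDual G, Matrix (Fin σ.dim) (Fin σ.dim) A}
    (hs : ∀ σ, S.IsIsotypic σ.rep (s σ)) (π : UnitaryRep G n) :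
    S.IsIsotypic π (extendFamily s π) := fun g => by
  rw [extendFamily_map, extendFamily_eq, extendFamily_eq, Matrix.mul_sum]
  refine Finset.sum_congr rfl fun k _ => ?_
  rw [Matrix.mul_assoc, ← Matrix.mul_assoc (Matrix.map _ _), ← Matrix.map_mul_of_hom,
    π.decomposition.isom_intertwines, Matrix.map_mul_of_hom, Matrix.mul_assoc (Matrix.map _ _),
    ← Matrix.mul_assoc (((π.decomposition.cls k).rep.mat g).map _), hs _ g, Matrix.mul_assoc]

theorem IsNondegIsometry.extendFamily_mul_conjTranspose_mul
    {s : ∀ σ : UnitaryDual G, Matrix (Fin σ.dim) (Fin σ.dim) A}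
    (hs : ∀ σ, S.IsNondegIsometry σ.rep (s σ)) {x : Matrix n l A} (hx : S.IsIsotypic π x) :
    extendFamily s π * ((extendFamily s π)ᴴ * x) = x := by
  rw [extendFamily_conjTranspose, ← Matrix.mul_assoc, ← extendFamily_mul, extendFamily_eq,
    Matrix.sum_mul]
  conv_rhs => rw [← π.decomposition.sum_map_isom x]
  refine Finset.sum_congr rfl fun k _ => ?_
  simp only [Matrix.mul_assoc]
  rw [(hs _).mul_conjTranspose_mul
    (hx.intertwine (π.decomposition.conjTranspose_isom_intertwines k))]

theorem IsNondegIsometry.extendFamily_conjTranspose_mul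
    {s : ∀ σ : UnitaryDual G, Matrix (Fin σ.dim) (Fin σ.dim) A}
    (hs : ∀ σ, S.IsNondegIsometry σ.rep (s σ)) (π : UnitaryRep G n) :
    (extendFamily s π)ᴴ * extendFamily s π = 1 := by
  rw [extendFamily_conjTranspose, ← extendFamily_mul]
  simp only [(hs _).2.1]
  exact extendFamily_one π

end CStarSystem

/-! ### The factor system relations -/

namespace FactorData

open CStarSystem

variable {G : Type*} [Group G] [TopologicalSpace G]
variable {A : Type*} [CStarAlgebra A] {A' : Type*} [CStarAlgebra A'] {B : Type*} [CStarAlgebra B]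
variable {S : CStarSystem G A B} {S' : CStarSystem G A' B} {F F' : FactorData G B}
variable {s : ∀ σ : UnitaryDual G, Matrix (Fin σ.dim) (Fin σ.dim) A}
variable {l m n p : Type*}

theorem IsAssociatedVia.mul_gamma (h : F.IsAssociatedVia S s) (σ : UnitaryDual G) (b : B) :
    s σ * (F.γ σ b).map S.incl = Matrix.scalar _ (S.incl b) * s σ := by
  rw [h.2.2.1, Matrix.mul_assoc]
  refine (h.1 σ).mul_conjTranspose_mul ((h.1 σ).isIsotypic.fixed_smul fun g => ?_)
  have : S.incl b ∈ Set.range S.incl := ⟨_, rfl⟩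
  rw [S.range_incl] at this
  exact this g

/-- The commutation rule `(y)₁₂ (s_τ)₁₃ = (s_τ)₁₃ (id ⊗ γ_τ)(y)`. -/
theorem IsAssociatedVia.mul_ampl (h : F.IsAssociatedVia S s) (τ : UnitaryDual G) [Fintype n]
    [DecidableEq n] (y : Matrix n n B) :
    ((1 : Matrix n n A) ⊗ₖ s τ) * (F.ampl τ y).map S.incl = y.map S.incl ⊗ₖ s τ := by
  ext ⟨i, k⟩ ⟨j, q⟩
  have := congrFun (congrFun (h.mul_gamma τ (y i j)) k) q
  simp only [Matrix.mul_apply, Matrix.map_apply, Matrix.scalar_apply, Matrix.diagonal_apply,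
    ite_mul, zero_mul, Finset.sum_ite_eq, Finset.mem_univ, if_true] at this
  simp [Matrix.mul_apply, Matrix.one_apply, Fintype.sum_prod_type, ampl, this]

/-- The relation `(s_σ)₁₂ (s_τ)₁₃ = s_{σ ⊗ τ} ω(σ, τ)`. -/
theorem IsAssociatedVia.extendFamily_mul_omega (h : F.IsAssociatedVia S s) (σ τ : UnitaryDual G) :
    extendFamily s (σ.rep.tensor τ.rep) * (F.ω σ τ).map S.incl = s σ ⊗ₖ s τ := by
  rw [h.2.2.2, Matrix.mul_assoc, Matrix.kronecker_eq_mul]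
  exact IsNondegIsometry.extendFamily_mul_conjTranspose_mul h.1
    ((h.1 σ).isIsotypic.kronecker (h.1 τ).isIsotypic)

/-- The multiplication rule of the system in terms of `(γ, ω)`. -/
theorem IsAssociatedVia.kronecker_mul (h : F.IsAssociatedVia S s) (σ τ : UnitaryDual G)
    (y : Matrix (Fin σ.dim) (Fin σ.dim) B) (z : Matrix (Fin τ.dim) (Fin τ.dim) B) :
    (s σ * y.map S.incl) ⊗ₖ (s τ * z.map S.incl) = extendFamily s (σ.rep.tensor τ.rep) *
      (F.ω σ τ * F.ampl τ y * ((1 : Matrix _ _ B) ⊗ₖ z)).map S.incl := by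
  rw [Matrix.map_mul_of_hom, Matrix.map_mul_of_hom, ← Matrix.mul_assoc, ← Matrix.mul_assoc,
    h.extendFamily_mul_omega, ← Matrix.kronecker_eq_mul (s σ), Matrix.mul_assoc (s σ ⊗ₖ 1),
    h.mul_ampl, ← Matrix.kronecker_eq_mul (y.map S.incl), ← Matrix.mul_assoc,
    ← Matrix.mul_kronecker_one, Matrix.mul_assoc (_ ⊗ₖ 1)]
  have : ((1 : Matrix (Fin σ.dim) (Fin σ.dim) B) ⊗ₖ z).map S.incl = 1 ⊗ₖ z.map S.incl := by
    ext i j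
    simp [Matrix.one_apply, apply_ite S.incl]
  rw [this, ← Matrix.one_kronecker_mul, Matrix.kronecker_eq_mul]

/-- Two factor systems of the same system are conjugated, by means of `v_σ = s_σ* t_σ`. -/
theorem IsAssociatedVia.conjugated (h : F.IsAssociatedVia S s)
    {t : ∀ σ : UnitaryDual G, Matrix (Fin σ.dim) (Fin σ.dim) A} (h' : F'.IsAssociatedVia S t) :
    F.Conjugated F' := by
  have hfix : ∀ σ, ∃ v : Matrix (Fin σ.dim) (Fin σ.dim) B, v.map S.incl = (s σ)ᴴ * t σ := fun σ =>
    ((h.1 σ).isIsotypic.conjTranspose_mul (h'.1 σ).isIsotypic).exists_map_incl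
  choose v hv using hfix
  have hst : ∀ σ, s σ * (v σ).map S.incl = t σ := fun σ => by
    rw [hv]
    exact (h.1 σ).mul_conjTranspose_mul (h'.1 σ).isIsotypic
  have hts : ∀ σ, t σ * ((v σ).map S.incl)ᴴ = s σ := fun σ => by
    rw [hv, Matrix.conjTranspose_mul, Matrix.conjTranspose_conjTranspose]
    exact (h'.1 σ).mul_conjTranspose_mul (h.1 σ).isIsotypic
  have hv1 : ∀ σ, (v σ)ᴴ * v σ = 1 := fun σ => by
    apply S.map_incl_injective
    simp only [Matrix.map_mul_of_hom, Matrix.map_conjTranspose_of_hom,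
      Matrix.map_one _ (map_zero S.incl) (map_one S.incl)]
    conv_lhs => enter [2]; rw [hv]
    rw [← Matrix.mul_assoc, ← Matrix.conjTranspose_mul, hst]
    exact (h'.1 σ).2.1
  have hv2 : ∀ σ, v σ * (v σ)ᴴ = 1 := fun σ => by
    apply S.map_incl_injective
    simp only [Matrix.map_mul_of_hom, Matrix.map_conjTranspose_of_hom,
      Matrix.map_one _ (map_zero S.incl) (map_one S.incl)]
    conv_lhs => enter [1]; rw [hv]
    rw [Matrix.mul_assoc, hts]
    exact (h.1 σ).2.1
  refine ⟨v, fun σ => ⟨hv1 σ, hv2 σ⟩, fun σ b => ?_, fun σ τ => ?_⟩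
  · apply S.map_incl_injective
    simp only [Matrix.map_mul_of_hom, Matrix.map_conjTranspose_of_hom]
    rw [h'.2.2.1, h.2.2.1, ← hst, Matrix.conjTranspose_mul]
    simp only [Matrix.mul_assoc]
  · apply S.map_incl_injective
    have h1 := h'.extendFamily_mul_omega σ τ
    have h2 : extendFamily t (σ.rep.tensor τ.rep) = extendFamily s (σ.rep.tensor τ.rep) *
        (extendFamily v (σ.rep.tensor τ.rep)).map S.incl := by
      rw [extendFamily_map, ← extendFamily_mul]
      simp only [hst]
    rw [h2, ← hst, ← hst, h.kronecker_mul] at h1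
    have h3 := congrArg (fun x => (extendFamily s (σ.rep.tensor τ.rep))ᴴ * x) h1
    simp only [← Matrix.mul_assoc] at h3
    rw [IsNondegIsometry.extendFamily_conjTranspose_mul h.1, Matrix.one_mul, Matrix.one_mul] at h3
    simpa only [Matrix.map_mul_of_hom] using h3

end FactorData

/-! ### The trivial representation -/

section Trivial

variable {G : Type*} [Group G] [TopologicalSpace G] {n l : Type*} [Fintype n] [DecidableEq n]

theorem UnitaryRep.IsIrreducible.eq_bot_or_eq_top {π : UnitaryRep G n} (hπ : π.IsIrreducible)
    (W : Submodule ℂ (n → ℂ)) (hW : ∀ g, ∀ x ∈ W, π.mat g *ᵥ x ∈ W) : W = ⊥ ∨ W = ⊤ := by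
  have : IsSimpleOrder (Subrepresentation π.toRepresentation) := hπ
  let V : Subrepresentation π.toRepresentation := ⟨W, fun g v hv => hW g v hv⟩
  rcases IsSimpleOrder.eq_bot_or_eq_top V with h | h
  · left
    exact congrArg Subrepresentation.toSubmodule h
  · right
    exact congrArg Subrepresentation.toSubmodule h

theorem UnitaryRep.IsIrreducible.nonempty {π : UnitaryRep G n} (hπ : π.IsIrreducible) :
    Nonempty n := by
  by_contra hn
  rw [not_nonempty_iff] at hn
  have : IsSimpleOrder (Subrepresentation π.toRepresentation) := hπ
  refine bot_ne_top (α := Subrepresentation π.toRepresentation) ?_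
  exact Subrepresentation.toSubmodule_injective (Subsingleton.elim _ _)

/-- A case of Schur's lemma: an intertwiner from an irreducible representation to a trivial one
vanishes, or the irreducible representation is itself trivial. -/
theorem UnitaryRep.IsIrreducible.eq_zero_or_mat_eq_one {π : UnitaryRep G n} (hπ : π.IsIrreducible)
    (r : Matrix l n ℂ) (hr : ∀ g, r * π.mat g = r) : r = 0 ∨ ∀ g, π.mat g = 1 := by
  rcases hπ.eq_bot_or_eq_top (LinearMap.ker r.mulVecLin) (fun g x hx => by
    rw [LinearMap.mem_ker, Matrix.mulVecLin_apply] at hx ⊢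
    rw [Matrix.mulVec_mulVec, hr, hx]) with h | h
  · right
    intro g
    refine Matrix.toLin'.injective (LinearMap.ext fun x => ?_)
    rw [← sub_eq_zero, ← Submodule.mem_bot ℂ, ← h, LinearMap.mem_ker]
    simp [Matrix.mulVec_sub, hr]
  · left
    ext i j
    have : Pi.single j 1 ∈ LinearMap.ker r.mulVecLin := by rw [h]; trivial
    simpa using congrFun (LinearMap.mem_ker.1 this) i

theorem UnitaryRep.IsIrreducible.subsingleton_of_mat_eq_one {π : UnitaryRep G n}
    (hπ : π.IsIrreducible) (h1 : ∀ g, π.mat g = 1) : Subsingleton n := by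
  refine ⟨fun i j => ?_⟩
  rcases hπ.eq_bot_or_eq_top (Submodule.span ℂ {Pi.single i 1}) (fun g x hx => by
    rwa [h1, Matrix.one_mulVec]) with h | h
  · rw [Submodule.span_singleton_eq_bot] at h
    simpa using congrFun h i
  · have : Pi.single j (1 : ℂ) ∈ Submodule.span ℂ {(Pi.single i 1 : n → ℂ)} := by rw [h]; trivial
    obtain ⟨c, hc⟩ := Submodule.mem_span_singleton.1 this
    by_contra hij
    simpa [Pi.single_apply, Ne.symm hij] using congrFun hc j

theorem UnitaryDual.eq_of_mat_eq_one {σ τ : UnitaryDual G} (hσ : ∀ g, σ.rep.mat g = 1)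
    (hτ : ∀ g, τ.rep.mat g = 1) : σ = τ := by
  have h1 := σ.isIrreducible_rep.subsingleton_of_mat_eq_one hσ
  have h2 := τ.isIrreducible_rep.subsingleton_of_mat_eq_one hτ
  have : Nonempty (Fin σ.dim) := σ.isIrreducible_rep.nonempty
  have : Nonempty (Fin τ.dim) := τ.isIrreducible_rep.nonempty
  have := uniqueOfSubsingleton (Classical.arbitrary (Fin σ.dim))
  have := uniqueOfSubsingleton (Classical.arbitrary (Fin τ.dim))
  have h : σ.rep.Equivalent τ.rep := by
    refine ⟨Matrix.of fun _ _ => 1, ?_, ?_, fun g => by rw [hσ, hτ, Matrix.mul_one, Matrix.one_mul]⟩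
    · ext i j
      rw [Subsingleton.elim i j]
      simp [Matrix.mul_apply]
    · ext i j
      rw [Subsingleton.elim i j]
      simp [Matrix.mul_apply]
  rw [← Quotient.out_eq σ, ← Quotient.out_eq τ]
  exact Quotient.sound h

/-- The one-dimensional trivial representation. -/
def UnitaryRep.trivial (G : Type*) [Group G] [TopologicalSpace G] : UnitaryRep G (Fin 1) :=
  ⟨1, continuous_const⟩

theorem UnitaryRep.mat_trivial (g : G) : (UnitaryRep.trivial G).mat g = 1 := rfl

theorem UnitaryDual.exists_mat_eq_one (G : Type*) [Group G] [TopologicalSpace G] :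
    ∃ σ : UnitaryDual G, ∀ g, σ.rep.mat g = 1 := by
  let D := (UnitaryRep.trivial G).decomposition
  have : Nonempty D.index := by
    by_contra h
    rw [not_nonempty_iff] at h
    have := D.isom_sum
    simp at this
  obtain ⟨k⟩ := this
  refine ⟨D.cls k, fun g => ?_⟩
  have h := congrArg (fun x => (D.isom k)ᴴ * x) (D.isom_intertwines k g)
  rw [UnitaryRep.mat_trivial, Matrix.one_mul, ← Matrix.mul_assoc, D.isom_isometry,
    Matrix.one_mul] at h
  exact h.symm

/-- If `s_1 = 1`, then an intertwiner `r` from `π` to a trivial representation satisfies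
`r s_π = r`: it only sees the trivial summands of `π`. -/
theorem mul_extendFamily_of_trivial {A : Type*} [Ring A] [Algebra ℂ A]
    {s : ∀ σ : UnitaryDual G, Matrix (Fin σ.dim) (Fin σ.dim) A}
    (hs : ∀ σ : UnitaryDual G, (∀ g, σ.rep.mat g = 1) → s σ = 1) (π : UnitaryRep G n)
    (r : Matrix l n ℂ) (hr : ∀ g, r * π.mat g = r) :
    r.map (algebraMap ℂ A) * extendFamily s π = r.map (algebraMap ℂ A) := by
  rw [extendFamily_eq, Matrix.mul_sum]
  conv_rhs => rw [← Matrix.mul_one (r.map (algebraMap ℂ A)),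
    ← π.decomposition.sum_map_isom (1 : Matrix n n A), Matrix.mul_sum]
  generalize π.decomposition = D
  refine Finset.sum_congr rfl fun k _ => ?_
  rw [Matrix.mul_one, Matrix.mul_assoc, ← Matrix.mul_assoc (r.map _), ← Matrix.mul_assoc (r.map _),
    ← Matrix.map_mul_of_hom]
  rcases (D.cls k).isIrreducible_rep.eq_zero_or_mat_eq_one (r * D.isom k) (fun g => by
    rw [Matrix.mul_assoc, ← D.isom_intertwines, ← Matrix.mul_assoc, hr]) with h | h
  · rw [h, Matrix.map_zero _ (map_zero _), Matrix.zero_mul, Matrix.zero_mul]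
  · rw [hs _ h, Matrix.one_mul]

end Trivial

/-! ### Conjugated factor systems belong to the same systems -/

namespace FactorData

open CStarSystem

variable {G : Type*} [Group G] [TopologicalSpace G]
variable {A : Type*} [CStarAlgebra A] {A' : Type*} [CStarAlgebra A'] {B : Type*} [CStarAlgebra B]
variable {S : CStarSystem G A B} {S' : CStarSystem G A' B} {F F' : FactorData G B}
variable {s : ∀ σ : UnitaryDual G, Matrix (Fin σ.dim) (Fin σ.dim) A}

theorem IsAssociatedVia.gamma_of_trivial (h : F.IsAssociatedVia S s) {σ : UnitaryDual G}
    (hσ : ∀ g, σ.rep.mat g = 1) (b : B) : F.γ σ b = Matrix.scalar _ b := by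
  apply S.map_incl_injective
  simp only
  rw [h.2.2.1, h.2.1 σ hσ, Matrix.conjTranspose_one, Matrix.one_mul, Matrix.mul_one]
  ext i j
  by_cases hij : i = j <;> simp [hij]

theorem IsAssociatedVia.omega_of_trivial (h : F.IsAssociatedVia S s) {σ : UnitaryDual G}
    (hσ : ∀ g, σ.rep.mat g = 1) : F.ω σ σ = 1 := by
  have hten : ∀ g, (σ.rep.tensor σ.rep).mat g = 1 := fun g => by
    rw [show (σ.rep.tensor σ.rep).mat g = σ.rep.mat g ⊗ₖ σ.rep.mat g from rfl, hσ,
      Matrix.one_kronecker_one]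
  have h1 := mul_extendFamily_of_trivial h.2.1 (σ.rep.tensor σ.rep) 
    (1 : Matrix (Fin σ.dim × Fin σ.dim) (Fin σ.dim × Fin σ.dim) ℂ)
    (fun g => by rw [hten, Matrix.mul_one])
  rw [Matrix.map_one _ (map_zero _) (map_one _), Matrix.one_mul] at h1
  have h2 := h.extendFamily_mul_omega σ σ
  rw [h1, h.2.1 σ hσ, Matrix.one_mul, Matrix.one_kronecker_one] at h2
  apply S.map_incl_injective
  simp only
  rw [h2, Matrix.map_one _ (map_zero _) (map_one _)]

/-- The unitaries of a conjugacy are automatically normalized: for the trivial class the cocycle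
relation reads `v₁ = v₁ v₁`. -/
theorem eq_one_of_trivial (h : F.IsAssociatedVia S s) {s' : ∀ σ : UnitaryDual G,
      Matrix (Fin σ.dim) (Fin σ.dim) A'} (h' : F'.IsAssociatedVia S' s')
    {v : ∀ σ : UnitaryDual G, Matrix (Fin σ.dim) (Fin σ.dim) B}
    (hv : ∀ σ, (v σ)ᴴ * v σ = 1 ∧ v σ * (v σ)ᴴ = 1)
    (hω : ∀ σ τ, extendFamily v (σ.rep.tensor τ.rep) * F'.ω σ τ =
      F.ω σ τ * F.ampl τ (v σ) * (1 ⊗ₖ v τ))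
    {σ : UnitaryDual G} (hσ : ∀ g, σ.rep.mat g = 1) : v σ = 1 := by
  have hsub := σ.isIrreducible_rep.subsingleton_of_mat_eq_one hσ
  obtain ⟨i₀⟩ := σ.isIrreducible_rep.nonempty
  have h1 := hω σ σ
  rw [h.omega_of_trivial hσ, h'.omega_of_trivial hσ, Matrix.one_mul, Matrix.mul_one] at h1
  have hsc : v σ = Matrix.scalar _ (v σ i₀ i₀) := by
    ext i j
    rw [Subsingleton.elim i i₀, Subsingleton.elim j i₀]
    simp
  set b := v σ i₀ i₀ with hb
  have hb' : b * star b = 1 := by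
    have := congrFun (congrFun (hv σ).2 i₀) i₀
    have huniv : (Finset.univ : Finset (Fin σ.dim)) = {i₀} :=
      Finset.eq_singleton_iff_unique_mem.2 ⟨Finset.mem_univ _, fun x _ => Subsingleton.elim _ _⟩
    simpa [Matrix.mul_apply, huniv] using this
  -- All summands of `σ ⊗ σ` are trivial, hence of class `σ`.
  have hten : ∀ g, (σ.rep.tensor σ.rep).mat g = 1 := fun g => by
    rw [show (σ.rep.tensor σ.rep).mat g = σ.rep.mat g ⊗ₖ σ.rep.mat g from rfl, hσ,
      Matrix.one_kronecker_one]
  have h2 : extendFamily v (σ.rep.tensor σ.rep) = Matrix.scalar _ b := by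
    rw [extendFamily_eq]
    generalize (σ.rep.tensor σ.rep).decomposition = D
    have hk : ∀ k, v (D.cls k) = Matrix.scalar _ b := fun k => by
      have hc : D.cls k = σ := by
        refine UnitaryDual.eq_of_mat_eq_one (fun g => ?_) hσ
        have h := congrArg (fun x => (D.isom k)ᴴ * x) (D.isom_intertwines k g)
        rw [hten, Matrix.one_mul, ← Matrix.mul_assoc, D.isom_isometry, Matrix.one_mul] at h
        exact h.symm
      rw [hc]
      exact hsc
    have hsum := D.sum_map_isom
      (1 : Matrix (Fin σ.dim × Fin σ.dim) (Fin σ.dim × Fin σ.dim) B)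
    simp only [Matrix.mul_one] at hsum
    conv_rhs => rw [← Matrix.mul_one (Matrix.scalar _ b), ← hsum, Matrix.mul_sum]
    refine Finset.sum_congr rfl fun k _ => ?_
    rw [hk, Matrix.map_scalar_mul_scalar, Matrix.mul_assoc]
  rw [h2] at h1
  have h3 := congrFun (congrFun h1 (i₀, i₀)) (i₀, i₀)
  have huniv : (Finset.univ : Finset (Fin σ.dim × Fin σ.dim)) = {(i₀, i₀)} :=
    Finset.eq_singleton_iff_unique_mem.2 ⟨Finset.mem_univ _, fun x _ => Subsingleton.elim _ _⟩
  simp only [Matrix.mul_apply, huniv, Finset.sum_singleton, ampl, h.gamma_of_trivial hσ] at h3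
  simp only [Matrix.scalar_apply, Matrix.diagonal_apply_eq, Matrix.of_apply,
    Matrix.kroneckerMap_apply, Matrix.one_apply_eq, one_mul, ← hb] at h3
  have h4 : b = 1 := by
    calc b = b * (b * star b) := by rw [hb', mul_one]
      _ = b * b * star b := (mul_assoc _ _ _).symm
      _ = 1 := by rw [← h3, hb']
  rw [hsc, h4, map_one]

theorem IsAssociatedVia.of_conjugacy (h : F.IsAssociatedVia S s) {s' : ∀ σ : UnitaryDual G,
      Matrix (Fin σ.dim) (Fin σ.dim) A'} (h' : F'.IsAssociatedVia S' s')
    {v : ∀ σ : UnitaryDual G, Matrix (Fin σ.dim) (Fin σ.dim) B}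
    (hv : ∀ σ, (v σ)ᴴ * v σ = 1 ∧ v σ * (v σ)ᴴ = 1)
    (hγ : ∀ σ b, F'.γ σ b = (v σ)ᴴ * F.γ σ b * v σ)
    (hω : ∀ σ τ, extendFamily v (σ.rep.tensor τ.rep) * F'.ω σ τ =
      F.ω σ τ * F.ampl τ (v σ) * (1 ⊗ₖ v τ)) :
    F'.IsAssociatedVia S fun σ => s σ * (v σ).map S.incl := by
  refine ⟨fun σ => ⟨(h.1 σ).isIsotypic.mul (isFixed_map_incl _), ?_, fun x hx => ?_⟩,
    fun σ hσ => ?_, fun σ b => ?_, fun σ τ => ?_⟩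
  · rw [Matrix.conjTranspose_mul, Matrix.mul_assoc, ← Matrix.mul_assoc (s σ)ᴴ, (h.1 σ).2.1,
      Matrix.one_mul, ← Matrix.map_conjTranspose_of_hom, ← Matrix.map_mul_of_hom, (hv σ).1,
      Matrix.map_one _ (map_zero _) (map_one _)]
  · rw [Matrix.conjTranspose_mul, Matrix.mul_assoc (s σ), ← Matrix.mul_assoc (Matrix.map _ _),
      ← Matrix.map_conjTranspose_of_hom, ← Matrix.map_mul_of_hom, (hv σ).2,
      Matrix.map_one _ (map_zero _) (map_one _), Matrix.one_mul]
    exact (h.1 σ).2.2 x hx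
  · simp only
    rw [h.2.1 σ hσ, eq_one_of_trivial h h' hv hω hσ, Matrix.map_one _ (map_zero _) (map_one _),
      Matrix.mul_one]
  · rw [hγ]
    simp only [Matrix.map_mul_of_hom, Matrix.map_conjTranspose_of_hom, h.2.2.1,
      Matrix.conjTranspose_mul, Matrix.mul_assoc]
  · rw [Matrix.mul_assoc, Matrix.kronecker_eq_mul, h.kronecker_mul, ← hω, extendFamily_mul,
      ← extendFamily_map, Matrix.map_mul_of_hom, Matrix.conjTranspose_mul, Matrix.mul_assoc,
      ← Matrix.mul_assoc (extendFamily s _)ᴴ, IsNondegIsometry.extendFamily_conjTranspose_mul h.1,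
      Matrix.one_mul, ← Matrix.mul_assoc, ← Matrix.map_conjTranspose_of_hom,
      ← Matrix.map_mul_of_hom, extendFamily_conjTranspose, ← extendFamily_mul]
    simp only [(hv _).1]
    rw [extendFamily_one, Matrix.map_one _ (map_zero _) (map_one _), Matrix.one_mul]

/-- Factor systems are transported along equivalences of systems. -/
theorem IsAssociatedVia.of_equiv {s' : ∀ σ : UnitaryDual G, Matrix (Fin σ.dim) (Fin σ.dim) A'}
    (h' : F'.IsAssociatedVia S' s') (φ : A ≃⋆ₐ[ℂ] A')
    (hφ : ∀ g a, φ (S.act g a) = S'.act g (φ a)) (hφB : ∀ b, φ (S.incl b) = S'.incl b) :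
    F'.IsAssociatedVia S fun σ => (s' σ).map φ.symm := by
  have hψ : ∀ g a, φ.symm (S'.act g a) = S.act g (φ.symm a) := fun g a => by
    rw [← φ.symm_apply_apply (S.act g (φ.symm a)), hφ, φ.apply_symm_apply]
  have hψB : ∀ b, φ.symm (S'.incl b) = S.incl b := fun b => by
    rw [← hφB, φ.symm_apply_apply]
  have hψB' : ∀ {l p : Type} (y : Matrix l p B), (y.map S'.incl).map φ.symm = y.map S.incl := by
    intro l p y
    ext i j
    exact hψB _
  refine ⟨fun σ => ⟨fun g => ?_, ?_, fun x hx => ?_⟩, fun σ hσ => ?_, fun σ b => ?_, fun σ τ => ?_⟩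
  · have h1 := congrArg (fun x => x.map φ.symm) ((h'.1 σ).1 g)
    simp only [Matrix.map_mul_of_hom, Matrix.map_scalar_of_hom] at h1
    refine Eq.trans ?_ h1
    congr 1
    ext i j
    exact (hψ _ _).symm
  · rw [← Matrix.map_conjTranspose_of_hom, ← Matrix.map_mul_of_hom, (h'.1 σ).2.1,
      Matrix.map_one _ (map_zero _) (map_one _)]
  · have hx' : x.map φ ∈ S'.genIsotypic σ.rep := fun g => by
      have h1 := congrArg (fun x => x.map φ) (hx g)
      simp only [Matrix.map_mul_of_hom, Matrix.map_scalar_of_hom] at h1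
      refine Eq.trans ?_ h1
      congr 1
      ext i j
      exact (hφ _ _).symm
    have h1 := congrArg (fun x => x.map φ.symm) ((h'.1 σ).2.2 _ hx')
    have h2 : (x.map φ).map φ.symm = x := by
      ext i j
      exact φ.symm_apply_apply _
    simpa only [Matrix.map_mul_of_hom, Matrix.map_conjTranspose_of_hom, h2] using h1
  · simp only
    rw [h'.2.1 σ hσ, Matrix.map_one _ (map_zero _) (map_one _)]
  · rw [← hψB', h'.2.2.1]
    simp only [Matrix.map_mul_of_hom, Matrix.map_conjTranspose_of_hom]
    congr 2
    ext i j
    by_cases hij : i = j <;> simp [hij, hψB]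
  · rw [← hψB', h'.2.2.2, Matrix.mul_assoc, Matrix.mul_assoc, Matrix.kronecker_eq_mul,
      Matrix.kronecker_eq_mul, Matrix.map_mul_of_hom, Matrix.map_conjTranspose_of_hom,
      extendFamily_map]
    congr 1
    ext i j
    simp

end FactorData

/-! ### The conditional expectation onto the fixed point algebra -/

section NormFormula

variable {A : Type*} [CStarAlgebra A] [PartialOrder A] [StarOrderedRing A]

/-- A faithful positive map detects the norm of a positive element `h` through the growth of
`‖E(hⁿ)‖`: for `r₀ < r` and `p = (h - r)₊` one has `rⁿ p ≤ ‖h‖ hⁿ`, so that `‖E(p)‖` is at most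
`‖h‖ (r₀ / r)ⁿ` for all `n`, whence `E(p) = 0` and `p = 0`. -/
theorem norm_le_of_forall_norm_map_pow_le {E : A →ₗ[ℂ] A} (hpos : ∀ a, 0 ≤ a → 0 ≤ E a)
    (hfaith : ∀ a, 0 ≤ a → E a = 0 → a = 0) {h : A} (hh : 0 ≤ h) {r₀ : ℝ} (hr₀ : 0 ≤ r₀)
    (hpow : ∀ n : ℕ, ‖E (h ^ (n + 1))‖ ≤ r₀ ^ (n + 1)) : ‖h‖ ≤ r₀ := by
  refine le_of_forall_gt_imp_ge_of_dense fun r hr => ?_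
  have hr0 : 0 < r := hr₀.trans_lt hr
  have hsa : IsSelfAdjoint h := .of_nonneg hh
  set p : A := cfc (fun x : ℝ => max 0 (x - r)) h with hp
  have hp0 : 0 ≤ p := cfc_nonneg fun x _ => le_max_left _ _
  have hspec : ∀ x ∈ spectrum ℝ h, 0 ≤ x ∧ x ≤ ‖h‖ := fun x hx =>
    ⟨spectrum_nonneg_of_nonneg hh hx, (le_abs_self x).trans (by
      have := spectrum.norm_le_norm_mul_of_mem hx
      rcases subsingleton_or_nontrivial A with hA | hA
      · simp [spectrum.of_subsingleton] at hx
      · simpa using this)⟩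
  have hle : ∀ n : ℕ, r ^ n • p ≤ ‖h‖ • h ^ n := fun n => by
    have h1 : r ^ n • p = cfc (fun x : ℝ => r ^ n • max 0 (x - r)) h := by
      rw [hp, ← cfc_smul (r ^ n) _ h]
    have h2 : ‖h‖ • h ^ n = cfc (fun x : ℝ => ‖h‖ • x ^ n) h := by
      rw [cfc_smul ‖h‖ (fun x : ℝ => x ^ n) h, cfc_pow_id h n]
    rw [h1, h2]
    refine cfc_mono fun x hx => ?_
    obtain ⟨hx0, hx1⟩ := hspec x hx
    simp only [smul_eq_mul]
    rcases le_total (x - r) 0 with hxr | hxr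
    · rw [max_eq_left hxr, mul_zero]
      positivity
    · rw [max_eq_right hxr, mul_comm]
      have : r ≤ x := by linarith
      gcongr
      linarith
  have hEp : ∀ n : ℕ, ‖E p‖ ≤ ‖h‖ * (r₀ / r) ^ (n + 1) := fun n => by
    have h1 : r ^ (n + 1) • E p ≤ ‖h‖ • E (h ^ (n + 1)) := by
      have := hpos _ (sub_nonneg.2 (hle (n + 1)))
      rw [map_sub, sub_nonneg] at this
      simpa only [LinearMap.map_smul_of_tower] using this
    have h2 := CStarAlgebra.norm_le_norm_of_nonneg_of_le
      (smul_nonneg (pow_nonneg hr0.le _) (hpos p hp0)) h1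
    rw [norm_smul, norm_smul, norm_norm, Real.norm_of_nonneg (pow_nonneg hr0.le _)] at h2
    rw [div_pow, ← mul_div_assoc, le_div_iff₀ (pow_pos hr0 _), mul_comm]
    exact h2.trans (mul_le_mul_of_nonneg_left (hpow n) (norm_nonneg _))
  have hlim : Filter.Tendsto (fun n : ℕ => ‖h‖ * (r₀ / r) ^ (n + 1)) Filter.atTop
      (nhds (‖h‖ * 0)) :=
    ((tendsto_pow_atTop_nhds_zero_of_lt_one (by positivity)
      ((div_lt_one hr0).2 hr)).comp (Filter.tendsto_add_atTop_nat 1)).const_mul _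
  rw [mul_zero] at hlim
  have hEp0 : E p = 0 := norm_le_zero_iff.1 (ge_of_tendsto' hlim hEp)
  have hp1 : p = 0 := hfaith p hp0 hEp0
  have hp2 : cfc (fun x : ℝ => max 0 (x - r)) h = cfc (fun _ : ℝ => (0 : ℝ)) h := by
    rw [← hp, hp1, cfc_const_zero]
  have hp3 := (cfc_eq_cfc_iff_eqOn (a := h)).1 hp2
  rw [← cfc_id ℝ h]
  refine norm_cfc_le hr0.le fun x hx => ?_
  have h3 : max 0 (x - r) = 0 := hp3 hx
  have h4 : x - r ≤ 0 := max_eq_left_iff.1 h3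
  rw [id, Real.norm_of_nonneg (hspec x hx).1]
  linarith

end NormFormula

open MeasureTheory in
theorem Continuous.integrable_of_compactSpace {X E : Type*} [TopologicalSpace X]
    [CompactSpace X] [MeasurableSpace X] [OpensMeasurableSpace X] [NormedAddCommGroup E]
    {f : X → E} (hf : Continuous f) (μ : Measure X) [IsFiniteMeasure μ] : Integrable f μ :=
  hf.integrable_of_hasCompactSupport (HasCompactSupport.of_compactSpace f)

namespace CStarSystem

open MeasureTheory

variable {G : Type*} [Group G] [TopologicalSpace G]
variable {A : Type*} [CStarAlgebra A] {B : Type*} [CStarAlgebra B]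

theorem norm_act (S : CStarSystem G A B) (g : G) (a : A) : ‖S.act g a‖ = ‖a‖ :=
  NonUnitalStarAlgHom.norm_map (S.act g) (S.act g).injective a

theorem norm_incl (S : CStarSystem G A B) (b : B) : ‖S.incl b‖ = ‖b‖ :=
  NonUnitalStarAlgHom.norm_map S.incl S.incl_injective b

theorem act_incl (S : CStarSystem G A B) (g : G) (b : B) : S.act g (S.incl b) = S.incl b := by
  have : S.incl b ∈ Set.range S.incl := ⟨_, rfl⟩
  rw [S.range_incl] at this
  exact this g

theorem act_nonneg [PartialOrder A] [StarOrderedRing A] (S : CStarSystem G A B) (g : G) {a : A}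
    (ha : 0 ≤ a) : 0 ≤ S.act g a := by
  rw [← map_zero (S.act g)]
  exact OrderHomClass.mono (S.act g) ha

variable [CompactSpace G] [MeasurableSpace G] [BorelSpace G]

/-- The average `E(a) = ∫ α_g(a) dg` over the group. -/
noncomputable def average (S : CStarSystem G A B) (μ : Measure G) [IsFiniteMeasure μ] :
    A →ₗ[ℂ] A where
  toFun a := ∫ g, S.act g a ∂μ
  map_add' a b := by
    simp only [map_add]
    exact integral_add ((S.continuous_act a).integrable_of_compactSpace μ)
      ((S.continuous_act b).integrable_of_compactSpace μ)
  map_smul' c a := by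
    simp only [map_smul]
    exact integral_smul c _

variable (S : CStarSystem G A B) (μ : Measure G) [IsProbabilityMeasure μ]

theorem average_apply (a : A) : S.average μ a = ∫ g, S.act g a ∂μ := rfl

theorem average_incl (b : B) : S.average μ (S.incl b) = S.incl b := by
  simp [average_apply, act_incl]

theorem norm_average_le (a : A) : ‖S.average μ a‖ ≤ ‖a‖ := by
  have := norm_integral_le_of_norm_le_const (μ := μ) (f := fun g => S.act g a) (C := ‖a‖)
    (Filter.Eventually.of_forall fun g => (S.norm_act g a).le)
  rwa [probReal_univ, mul_one] at this

theorem exists_setAverage_act_mem_closedBall [μ.IsOpenPosMeasure] (a : A) {ε : ℝ} (hε : 0 < ε) :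
    ∃ U : Set G, IsOpen U ∧ ⨍ g in U, S.act g a ∂μ ∈ Metric.closedBall a ε := by
  have hcont := S.continuous_act a
  let U : Set G := {g | ‖S.act g a - a‖ < ε}
  have hU : IsOpen U := isOpen_lt (hcont.sub continuous_const).norm continuous_const
  have h1U : (1 : G) ∈ U := by
    change ‖S.act 1 a - a‖ < ε
    simpa using hε
  exact ⟨U, hU, Convex.set_average_mem (convex_closedBall a ε) Metric.isClosed_closedBall
    (hU.measure_ne_zero μ ⟨1, h1U⟩) (measure_ne_top μ U)
    ((ae_restrict_iff' hU.measurableSet).2 (Filter.Eventually.of_forall fun g hg => by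
      rw [mem_closedBall_iff_norm]
      exact le_of_lt hg)) (hcont.integrable_of_compactSpace μ).integrableOn⟩

section Order

variable [PartialOrder A] [StarOrderedRing A]

theorem average_nonneg {a : A} (ha : 0 ≤ a) : 0 ≤ S.average μ a :=
  integral_nonneg fun g => S.act_nonneg g ha

/-- The average is faithful: if `E(a) = 0`, then the integral of `α_g(a) ≥ 0` vanishes over each
neighbourhood of `1`, where `α_g(a)` is close to `a`. -/
theorem eq_zero_of_average_eq_zero [μ.IsOpenPosMeasure] {a : A} (ha : 0 ≤ a)
    (h : S.average μ a = 0) : a = 0 := by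
  rw [← norm_le_zero_iff]
  refine le_of_forall_gt_imp_ge_of_dense fun ε hε => ?_
  obtain ⟨U, hU, hmem⟩ := S.exists_setAverage_act_mem_closedBall μ a hε
  have hcont := S.continuous_act a
  have h0 : ∫ g in U, S.act g a ∂μ = 0 := by
    refine le_antisymm ?_ (integral_nonneg fun g => S.act_nonneg g ha)
    rw [← h, average_apply, ← integral_add_compl hU.measurableSet
      (hcont.integrable_of_compactSpace μ), le_add_iff_nonneg_right]
    exact integral_nonneg fun g => S.act_nonneg g ha
  rw [setAverage_eq, h0, smul_zero, mem_closedBall_iff_norm, zero_sub, norm_neg] at hmem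
  exact hmem

end Order

/-- The average annihilates the isotypic components of non-trivial irreducible representations,
since `∫ π_g* dg` is an intertwiner from `π` to a trivial representation. -/
theorem average_isotypic_eq_zero [IsTopologicalGroup G] [μ.IsMulLeftInvariant]
    {n l : Type*} [Fintype n] [DecidableEq n] {S : CStarSystem G A B}
    {π : UnitaryRep G n} (hπ : π.IsIrreducible) (htriv : ¬ ∀ g, π.mat g = 1) {x : Matrix n l A}
    (hx : S.IsIsotypic π x) (i : n) (j : l) : S.average μ (x i j) = 0 := by
  have hcont : ∀ i k, Continuous fun g => π.mat g⁻¹ i k := fun i k =>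
    (π.continuous_mat.matrix_elem i k).comp continuous_inv
  let r : Matrix n n ℂ := Matrix.of fun i k => ∫ g, π.mat g⁻¹ i k ∂μ
  have hr : ∀ h, r * π.mat h = r := fun h => by
    ext i k
    simp only [r, Matrix.mul_apply, Matrix.of_apply]
    simp_rw [← integral_mul_const]
    rw [← integral_finsetSum _ fun m _ =>
      ((hcont i m).integrable_of_compactSpace μ).mul_const _,
      ← integral_mul_left_eq_self (fun g => π.mat g⁻¹ i k) h⁻¹]
    refine integral_congr_ae (Filter.Eventually.of_forall fun g => ?_)
    simp only [mul_inv_rev, inv_inv, π.mat_mul, Matrix.mul_apply]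
  have hr0 : r = 0 := (hπ.eq_zero_or_mat_eq_one r hr).resolve_right htriv
  have hact : ∀ g, S.act g (x i j) = ∑ k, π.mat g⁻¹ i k • x k j := fun g => by
    have := congrFun (congrFun (isIsotypic_iff.1 hx g) i) j
    simpa [Matrix.mul_apply, Algebra.smul_def] using this
  rw [average_apply]
  simp_rw [hact]
  rw [integral_finsetSum _ fun k _ => ((hcont i k).integrable_of_compactSpace μ).smul_const _]
  refine Finset.sum_eq_zero fun k _ => ?_
  rw [integral_smul_const, show ∫ g, π.mat g⁻¹ i k ∂μ = r i k from rfl, hr0, Matrix.zero_apply,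
    zero_smul]

end CStarSystem

/-! ### The Peter–Weyl theorem -/

section PeterWeyl

open MeasureTheory BoundedContinuousFunction Module.End

variable {G : Type*} [Group G] [TopologicalSpace G]
variable {H : Type*} [NormedAddCommGroup H] [InnerProductSpace ℂ H]

theorem map_mul_linearIsometry_apply {G : Type*} [Group G] (U : G →* (H →ₗᵢ[ℂ] H)) (g h : G)
    (x : H) : U (g * h) x = U g (U h x) := by
  rw [map_mul]
  rfl

theorem inner_linearIsometry_inv {G : Type*} [Group G] (U : G →* (H →ₗᵢ[ℂ] H)) (g : G) (x y : H) :
    inner ℂ (U g⁻¹ x) y = inner ℂ x (U g y) := by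
  rw [← (U g).inner_map_map, ← map_mul_linearIsometry_apply, mul_inv_cancel, map_one,
    LinearIsometry.coe_one, id]

/-- A unitary representation on a finite-dimensional invariant subspace, in coordinates. -/
theorem exists_unitaryRep_of_invariant (U : G →* (H →ₗᵢ[ℂ] H))
    (hU : ∀ x, Continuous fun g => U g x) (W : Submodule ℂ H) [FiniteDimensional ℂ W]
    (hW : ∀ g, ∀ w ∈ W, U g w ∈ W) :
    ∃ (d : ℕ) (e : Fin d → H) (ρ : UnitaryRep G (Fin d)), W ≤ Submodule.span ℂ (Set.range e) ∧
      ∀ g j, U g (e j) = ∑ k, ρ.mat g k j • e k := by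
  let b := stdOrthonormalBasis ℂ W
  let r : G → Matrix (Fin (Module.finrank ℂ W)) (Fin (Module.finrank ℂ W)) ℂ := fun g =>
    Matrix.of fun i j => inner ℂ (b i : H) (U g (b j))
  have hexp : ∀ w ∈ W, ∑ k, inner ℂ (b k : H) w • (b k : H) = w := fun w hw => by
    simpa using congrArg (Subtype.val : W → H) (b.sum_repr' ⟨w, hw⟩)
  have hr : ∀ g j, U g (b j) = ∑ k, r g k j • (b k : H) := fun g j =>
    (hexp _ (hW g _ (b j).2)).symm
  have hr1 : r 1 = 1 := by
    ext i j
    have := orthonormal_iff_ite.1 b.orthonormal i j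
    simpa [r, Matrix.one_apply] using this
  have hrmul : ∀ g h, r (g * h) = r g * r h := fun g h => by
    ext i j
    simp only [r, Matrix.of_apply, Matrix.mul_apply, map_mul_linearIsometry_apply]
    conv_lhs => rw [hr h j]
    simp [r, mul_comm]
  have hrstar : ∀ g, (r g)ᴴ = r g⁻¹ := fun g => by
    ext i j
    simp only [r, Matrix.conjTranspose_apply, Matrix.of_apply, RCLike.star_def, inner_conj_symm]
    have := inner_linearIsometry_inv U g⁻¹ (b i : H) (b j)
    rwa [inv_inv] at this
  refine ⟨_, fun j => b j, ⟨⟨⟨fun g => ⟨r g, ?_⟩, Subtype.ext hr1⟩,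
    fun g h => Subtype.ext (hrmul g h)⟩, ?_⟩, fun w hw => ?_, hr⟩
  · rw [Matrix.mem_unitaryGroup_iff, Matrix.star_eq_conjTranspose, hrstar, ← hrmul,
      mul_inv_cancel, hr1]
  · exact continuous_matrix fun i j => continuous_const.inner (hU _)
  · rw [← hexp w hw]
    exact Submodule.sum_mem _ fun k _ => Submodule.smul_mem _ _ (Submodule.subset_span ⟨k, rfl⟩)

variable [CompactSpace G]

/-- The operator that maps `h` to the matrix coefficient `x ↦ ⟨U_x f, h⟩`. -/
noncomputable def coefficientMap (U : G →* (H →ₗᵢ[ℂ] H)) (hU : ∀ x, Continuous fun g => U g x)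
    (f : H) : H →L[ℂ] (G →ᵇ ℂ) :=
  LinearMap.mkContinuous
    { toFun := fun h => mkOfCompact ⟨fun x => inner ℂ (U x f) h, (hU f).inner continuous_const⟩
      map_add' := fun h h' => by ext x; simp
      map_smul' := fun c h => by ext x; simp } ‖f‖ fun h => by
    rw [norm_le (by positivity)]
    intro x
    have := norm_inner_le_norm (𝕜 := ℂ) (U x f) h
    rwa [LinearIsometry.norm_map] at this

theorem coefficientMap_apply (U : G →* (H →ₗᵢ[ℂ] H)) (hU : ∀ x, Continuous fun g => U g x)
    (f h : H) (x : G) : coefficientMap U hU f h x = inner ℂ (U x f) h := rfl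

/-- By the Arzelà–Ascoli theorem, as the orbit map `x ↦ U_x f` is continuous. -/
theorem isCompactOperator_coefficientMap (U : G →* (H →ₗᵢ[ℂ] H))
    (hU : ∀ x, Continuous fun g => U g x) (f : H) : IsCompactOperator (coefficientMap U hU f) := by
  refine (isCompactOperator_iff_isCompact_closure_image_closedBall
    (coefficientMap U hU f : H →ₗ[ℂ] (G →ᵇ ℂ)) one_pos).2 ?_
  refine arzela_ascoli (Metric.closedBall 0 ‖f‖) (isCompact_closedBall _ _) _ ?_ ?_
  · rintro _ x ⟨h, hh, rfl⟩
    rw [mem_closedBall_zero_iff] at hh ⊢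
    have := norm_inner_le_norm (𝕜 := ℂ) (U x f) h
    rw [LinearIsometry.norm_map] at this
    exact this.trans (mul_le_of_le_one_right (norm_nonneg _) hh)
  · intro x₀
    rw [Metric.equicontinuousAt_iff_right]
    intro ε hε
    have h1 := Metric.continuousAt_iff'.1 ((hU f).continuousAt (x := x₀)) ε hε
    filter_upwards [h1] with x hx
    rintro ⟨_, h, hh, rfl⟩
    rw [mem_closedBall_zero_iff] at hh
    change dist (inner ℂ (U x₀ f) h) (inner ℂ (U x f) h) < ε
    rw [dist_comm, dist_eq_norm, ← inner_sub_left]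
    refine lt_of_le_of_lt (norm_inner_le_norm (𝕜 := ℂ) _ _) ?_
    rw [dist_eq_norm] at hx
    exact (mul_le_of_le_one_right (norm_nonneg _) hh).trans_lt hx

variable [MeasurableSpace G] [BorelSpace G] [IsTopologicalGroup G] [CompleteSpace H]

/-- In a unitary representation of a compact group on a Hilbert space, the finite-dimensional
invariant subspaces span a dense subspace. If `f` is orthogonal to all of them, then, with `T` the
map to the matrix coefficients of `f` in `L²(G)`, the compact positive operator `T* T` commutes with
the representation, so that its eigenspaces for non-zero eigenvalues are orthogonal to `f`. By the
spectral theorem `T* T f = 0`, so `⟨U_x f, f⟩` vanishes identically. -/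
theorem eq_zero_of_orthogonal_finiteDimensional (μ : Measure G) [IsFiniteMeasure μ]
    [μ.IsMulLeftInvariant] [μ.IsOpenPosMeasure] (U : G →* (H →ₗᵢ[ℂ] H))
    (hU : ∀ x, Continuous fun g => U g x) (f : H)
    (hf : ∀ W : Submodule ℂ H, FiniteDimensional ℂ W → (∀ g, ∀ w ∈ W, U g w ∈ W) →
      ∀ w ∈ W, inner ℂ w f = 0) : f = 0 := by
  let T : H →L[ℂ] Lp ℂ 2 μ := (toLp 2 μ ℂ).comp (coefficientMap U hU f)
  let R : H →L[ℂ] H := (ContinuousLinearMap.adjoint T).comp T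
  have hinner : ∀ h h', inner ℂ (R h) h' = ∫ x, inner ℂ (U x f) h' * inner ℂ h (U x f) ∂μ := by
    intro h h'
    have h1 : inner ℂ (R h) h' = inner ℂ (T h) (T h') :=
      ContinuousLinearMap.adjoint_inner_left T h' (T h)
    rw [h1]
    refine (BoundedContinuousFunction.inner_toLp μ _ _).trans ?_
    refine integral_congr_ae (Filter.Eventually.of_forall fun x => ?_)
    change inner ℂ (U x f) h' * (starRingEnd ℂ) (inner ℂ (U x f) h) = _
    rw [inner_conj_symm]
  have hRsymm : R.IsSymmetric := fun h h' => by
    change inner ℂ (ContinuousLinearMap.adjoint T (T h)) h' =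
      inner ℂ h (ContinuousLinearMap.adjoint T (T h'))
    rw [ContinuousLinearMap.adjoint_inner_left, ContinuousLinearMap.adjoint_inner_right]
  have hRcomp : IsCompactOperator R :=
    ((isCompactOperator_coefficientMap U hU f).clm_comp (toLp 2 μ ℂ)).clm_comp
      (ContinuousLinearMap.adjoint T)
  have hcomm : ∀ g h, R (U g h) = U g (R h) := fun g h => by
    refine ext_inner_right ℂ fun h' => ?_
    have h2 := inner_linearIsometry_inv U g⁻¹ (R h) h'
    rw [inv_inv] at h2
    rw [h2, hinner, hinner, ← integral_mul_left_eq_self _ g]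
    refine integral_congr_ae (Filter.Eventually.of_forall fun x => ?_)
    simp only [map_mul_linearIsometry_apply, LinearIsometry.inner_map_map]
    rw [← inner_linearIsometry_inv U g⁻¹, inv_inv]
  have hRf : R f ∈ (⨆ c, eigenspace (R : Module.End ℂ H) c)ᗮ := by
    rw [← Submodule.iInf_orthogonal, Submodule.mem_iInf]
    intro c
    rw [Submodule.mem_orthogonal]
    intro e he
    have he' : R e = c • e := mem_eigenspace_iff.1 he
    have h1 : inner ℂ e (R f) = inner ℂ (R e) f := (hRsymm e f).symm
    rw [h1, he', inner_smul_left]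
    by_cases hc : c = 0
    · simp [hc]
    · have hfin := ContinuousLinearMap.finite_dimensional_eigenspace hRcomp c hc
      rw [hf _ hfin (fun g w hw => ?_) e he, mul_zero]
      rw [mem_eigenspace_iff] at hw ⊢
      change R (U g w) = c • U g w
      rw [hcomm, show R w = c • w from hw, map_smul]
  rw [ContinuousLinearMap.orthogonalComplement_iSup_eigenspaces_eq_bot hRcomp hRsymm,
    Submodule.mem_bot] at hRf
  have hTf : T f = 0 := by
    have h1 : inner ℂ (R f) f = inner ℂ (T f) (T f) :=
      ContinuousLinearMap.adjoint_inner_left T f (T f)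
    rw [hRf, inner_zero_left] at h1
    exact inner_self_eq_zero.1 h1.symm
  have hSf : coefficientMap U hU f f = 0 :=
    toLp_injective (p := 2) (𝕜 := ℂ) μ (hTf.trans (map_zero _).symm)
  have := congrArg (fun u : G →ᵇ ℂ => u 1) hSf
  simpa [coefficientMap_apply] using this

end PeterWeyl

/-! ### Density of the isotypic components -/

section Conj

variable {G : Type*} [Group G] [TopologicalSpace G] {n l : Type*} [Fintype n] [DecidableEq n]

/-- The conjugate representation, with the entrywise conjugate matrices. -/
def UnitaryRep.conj (π : UnitaryRep G n) : UnitaryRep G n where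
  toHom :=
    { toFun := fun g => ⟨(π.mat g).map (starRingEnd ℂ), by
        have h : ((π.mat g).map (starRingEnd ℂ))ᴴ = (π.mat g⁻¹).map (starRingEnd ℂ) := by
          rw [← π.conjTranspose_mat]
          ext i j
          simp
        rw [Matrix.mem_unitaryGroup_iff, Matrix.star_eq_conjTranspose, h, ← Matrix.map_mul_of_hom,
          ← π.mat_mul, mul_inv_cancel, π.mat_one, Matrix.map_one _ (map_zero _) (map_one _)]⟩
      map_one' := Subtype.ext (by
        simp only [π.mat_one, Matrix.map_one _ (map_zero (starRingEnd ℂ)) (map_one _)]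
        rfl)
      map_mul' := fun g h => Subtype.ext (by
        simp only [π.mat_mul, Matrix.map_mul_of_hom]
        rfl) }
  continuous_toHom := by
    exact π.continuous_mat.matrix_map Complex.continuous_conj

theorem UnitaryRep.conj_mat (π : UnitaryRep G n) (g : G) :
    π.conj.mat g = (π.mat g).map (starRingEnd ℂ) := rfl

variable {A : Type*} [CStarAlgebra A] {B : Type*} [CStarAlgebra B]

theorem CStarSystem.IsIsotypic.conj {S : CStarSystem G A B} {π : UnitaryRep G n}
    {x : Matrix n l A} (hx : S.IsIsotypic π x) : S.IsIsotypic π.conj (x.map star) := fun g => by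
  ext i j
  have := congrArg star (congrFun (congrFun (hx g) i) j)
  simp only [Matrix.mul_apply, Matrix.map_apply, star_sum, star_mul] at this ⊢
  rw [← this]
  refine Finset.sum_congr rfl fun k _ => ?_
  rw [π.conj_mat, Matrix.map_apply, map_star, Algebra.commutes]
  exact congrArg _ (algebraMap_star_comm _)

end Conj

section LeftRegular

open MeasureTheory

variable {G : Type*} [Group G] [TopologicalSpace G] [IsTopologicalGroup G]
variable [MeasurableSpace G] [BorelSpace G] (μ : Measure G) [μ.IsMulLeftInvariant]

/-- The left regular representation `(λ_g f)(x) = f(g⁻¹ x)` on `L²(G)`. -/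
noncomputable def leftRegular : G →* (Lp ℂ 2 μ →ₗᵢ[ℂ] Lp ℂ 2 μ) where
  toFun g :=
    { toFun := fun f => DomMulAct.mk g⁻¹ • f
      map_add' := fun f f' => smul_add _ f f'
      map_smul' := fun c f => smul_comm _ c f
      norm_map' := fun f => DomMulAct.norm_smul_Lp _ f }
  map_one' := by
    ext1 f
    change DomMulAct.mk (1 : G)⁻¹ • f = f
    rw [inv_one, DomMulAct.mk_one, one_smul]
  map_mul' g h := by
    ext1 f
    change DomMulAct.mk (g * h)⁻¹ • f = DomMulAct.mk g⁻¹ • DomMulAct.mk h⁻¹ • f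
    rw [mul_inv_rev, DomMulAct.mk_mul, mul_smul]

theorem leftRegular_ae_eq (g : G) (f : Lp ℂ 2 μ) :
    leftRegular μ g f =ᵐ[μ] fun x => f (g⁻¹ * x) :=
  DomMulAct.smul_Lp_ae_eq (DomMulAct.mk g⁻¹) f

theorem continuous_leftRegular [IsFiniteMeasure μ] [μ.Regular] (f : Lp ℂ 2 μ) :
    Continuous fun g => leftRegular μ g f := by
  have h1 : Continuous fun g : G => DomMulAct.mk g⁻¹ :=
    DomMulAct.continuous_mk.comp continuous_inv
  have : Fact ((2 : ENNReal) ≠ ⊤) := ⟨ENNReal.ofNat_ne_top⟩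
  exact h1.smul continuous_const

end LeftRegular

namespace CStarSystem

open MeasureTheory

variable {G : Type*} [Group G] [TopologicalSpace G]
variable {A : Type*} [CStarAlgebra A] {B : Type*} [CStarAlgebra B]

/-- The sum of the isotypic components of `A`: the span of the entries of the elements of
`A ⊗ Hom(ℂ, V_σ)` that are isotypic for some `σ ∈ Ĝ`. -/
noncomputable def isotypicSpan (S : CStarSystem G A B) : Submodule ℂ A :=
  Submodule.span ℂ {a | ∃ (σ : UnitaryDual G) (x : Matrix (Fin σ.dim) Unit A),
    S.IsIsotypic σ.rep x ∧ ∃ i, a = x i ()}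

theorem IsIsotypic.mem_isotypicSpan {S : CStarSystem G A B} {n : Type*} [Fintype n]
    [DecidableEq n] {π : UnitaryRep G n} {x : Matrix n Unit A} (hx : S.IsIsotypic π x) (i : n) :
    x i () ∈ S.isotypicSpan := by
  rw [← π.decomposition.sum_map_isom x, Matrix.sum_apply]
  refine Submodule.sum_mem _ fun k _ => ?_
  rw [Matrix.mul_apply]
  refine Submodule.sum_mem _ fun j _ => ?_
  rw [Matrix.map_apply, ← Algebra.smul_def]
  exact Submodule.smul_mem _ _ (Submodule.subset_span
    ⟨_, _, hx.intertwine (π.decomposition.conjTranspose_isom_intertwines k), j, rfl⟩)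

variable [CompactSpace G] [MeasurableSpace G] [BorelSpace G]
variable (S : CStarSystem G A B) (μ : Measure G) [IsProbabilityMeasure μ]

theorem integrable_smul_act (a : A) (f : Lp ℂ 2 μ) :
    Integrable (fun g => f g • S.act g a) μ := by
  have h1 : Integrable f μ := (Lp.memLp f).integrable one_le_two
  refine h1.smul_bdd ‖a‖
    ((S.continuous_act a).integrable_of_compactSpace μ).aestronglyMeasurable ?_
  exact Filter.Eventually.of_forall fun g => (S.norm_act g a).le

/-- The smearing map `f ↦ ∫ f(g) α_g(a) dg` from `L²(G)` to `A`. -/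
noncomputable def smear (a : A) : Lp ℂ 2 μ →L[ℂ] A :=
  LinearMap.mkContinuous
    { toFun := fun f => ∫ g, f g • S.act g a ∂μ
      map_add' := fun f f' => by
        rw [← integral_add (S.integrable_smul_act μ a f) (S.integrable_smul_act μ a f')]
        refine integral_congr_ae ?_
        filter_upwards [Lp.coeFn_add f f'] with g hg
        rw [hg, Pi.add_apply, add_smul]
      map_smul' := fun c f => by
        rw [RingHom.id_apply, ← integral_smul]
        refine integral_congr_ae ?_
        filter_upwards [Lp.coeFn_smul c f] with g hg
        rw [hg, Pi.smul_apply, smul_eq_mul, mul_smul] } ‖a‖ fun f => by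
    have h1 : Integrable f μ := (Lp.memLp f).integrable one_le_two
    have h2 : ∫ g, ‖f g‖ ∂μ ≤ ‖f‖ := by
      rw [integral_norm_eq_lintegral_enorm h1.aestronglyMeasurable, ← eLpNorm_one_eq_lintegral_enorm,
        Lp.norm_def]
      exact ENNReal.toReal_mono (Lp.eLpNorm_ne_top f)
        (eLpNorm_le_eLpNorm_of_exponent_le one_le_two h1.aestronglyMeasurable)
    calc ‖∫ g, f g • S.act g a ∂μ‖ ≤ ∫ g, ‖f g • S.act g a‖ ∂μ := norm_integral_le_integral_norm _
      _ = (∫ g, ‖f g‖ ∂μ) * ‖a‖ := by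
        simp_rw [norm_smul, norm_act]
        rw [integral_mul_const]
      _ ≤ ‖a‖ * ‖f‖ := by
        rw [mul_comm]
        exact mul_le_mul_of_nonneg_left h2 (norm_nonneg _)

theorem smear_apply (a : A) (f : Lp ℂ 2 μ) : S.smear μ a f = ∫ g, f g • S.act g a ∂μ := rfl

/-- Smearing with normalized indicator functions of small neighbourhoods of `1`. -/
theorem mem_closure_range_smear [μ.IsOpenPosMeasure] (a : A) :
    a ∈ closure (Set.range (S.smear μ a)) := by
  rw [Metric.mem_closure_iff]
  intro ε hε
  obtain ⟨U, hU, hmem⟩ := S.exists_setAverage_act_mem_closedBall μ a (half_pos hε)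
  refine ⟨_, ⟨indicatorConstLp 2 hU.measurableSet (measure_ne_top μ U)
    (((μ.real U)⁻¹ : ℝ) : ℂ), rfl⟩, ?_⟩
  have heq : S.smear μ a (indicatorConstLp 2 hU.measurableSet (measure_ne_top μ U)
      (((μ.real U)⁻¹ : ℝ) : ℂ)) = ⨍ g in U, S.act g a ∂μ := by
    rw [smear_apply, setAverage_eq, ← integral_smul, ← integral_indicator hU.measurableSet]
    refine integral_congr_ae ?_
    filter_upwards [indicatorConstLp_coeFn (p := 2) (hs := hU.measurableSet)
      (hμs := measure_ne_top μ U) (c := (((μ.real U)⁻¹ : ℝ) : ℂ))] with g hg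
    rw [hg]
    by_cases h : g ∈ U
    · rw [Set.indicator_of_mem h, Set.indicator_of_mem h]
      exact Complex.coe_smul _ _
    · rw [Set.indicator_of_notMem h, Set.indicator_of_notMem h, zero_smul]
  rw [heq, dist_comm]
  exact lt_of_le_of_lt hmem (by linarith)

variable [IsTopologicalGroup G] [μ.IsMulLeftInvariant]

theorem act_smear (a : A) (f : Lp ℂ 2 μ) (h : G) :
    S.act h (S.smear μ a f) = S.smear μ a (leftRegular μ h f) := by
  have h1 : S.act h (S.smear μ a f) = ∫ g, S.act h (f g • S.act g a) ∂μ := by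
    let L : A →L[ℂ] A := LinearMap.mkContinuous (S.act h : A →ₗ[ℂ] A) 1 fun x => by
      rw [one_mul]
      exact (S.norm_act h x).le
    exact (L.integral_comp_comm (S.integrable_smul_act μ a f)).symm
  rw [h1, smear_apply, ← integral_mul_left_eq_self _ h⁻¹]
  refine integral_congr_ae ?_
  filter_upwards [leftRegular_ae_eq μ h f] with g hg
  rw [hg, map_smul, ← StarAlgEquiv.mul_apply, ← map_mul, mul_inv_cancel_left]

/-- The sum of the isotypic components is dense: smearing maps finite-dimensional invariant
subspaces of `L²(G)` into it, and these span a dense subspace. -/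
theorem topologicalClosure_isotypicSpan [μ.Regular] [μ.IsOpenPosMeasure] :
    S.isotypicSpan.topologicalClosure = ⊤ := by
  rw [Submodule.eq_top_iff']
  intro a
  let D : Submodule ℂ (Lp ℂ 2 μ) :=
    S.isotypicSpan.topologicalClosure.comap (S.smear μ a : Lp ℂ 2 μ →ₗ[ℂ] A)
  have hDc : IsClosed (D : Set (Lp ℂ 2 μ)) :=
    S.isotypicSpan.isClosed_topologicalClosure.preimage (S.smear μ a).continuous
  have hfin : ∀ W : Submodule ℂ (Lp ℂ 2 μ), FiniteDimensional ℂ W →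
      (∀ g, ∀ w ∈ W, leftRegular μ g w ∈ W) → W ≤ D := fun W hWfin hW => by
    obtain ⟨d, e, ρ, hspan, he⟩ :=
      exists_unitaryRep_of_invariant (leftRegular μ) (continuous_leftRegular μ) W hW
    refine hspan.trans (Submodule.span_le.2 ?_)
    rintro _ ⟨i, rfl⟩
    refine S.isotypicSpan.le_topologicalClosure ?_
    have hiso : S.IsIsotypic ρ.conj (Matrix.of fun i (_ : Unit) => S.smear μ a (e i)) := by
      rw [isIsotypic_iff]
      intro g
      ext i j
      rw [Matrix.map_apply, Matrix.of_apply, act_smear, he, map_sum, Matrix.mul_apply]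
      refine Finset.sum_congr rfl fun k _ => ?_
      rw [map_smul, Matrix.map_apply, Matrix.of_apply, ← Algebra.smul_def, ρ.conj_mat,
        ← ρ.conjTranspose_mat]
      simp
    exact hiso.mem_isotypicSpan i
  have hD : D = ⊤ := by
    have hcomplete : D.HasOrthogonalProjection := by
      have : CompleteSpace D := hDc.completeSpace_coe
      infer_instance
    rw [← Submodule.orthogonal_eq_bot_iff, Submodule.eq_bot_iff]
    intro f hf
    exact eq_zero_of_orthogonal_finiteDimensional μ (leftRegular μ) (continuous_leftRegular μ) f
      fun W hWfin hW w hw => (Submodule.mem_orthogonal _ _).1 hf w (hfin W hWfin hW hw)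
  have hsub : closure (Set.range (S.smear μ a)) ⊆ S.isotypicSpan.topologicalClosure := by
    refine closure_minimal ?_ S.isotypicSpan.isClosed_topologicalClosure
    rintro _ ⟨f, rfl⟩
    have : f ∈ D := by rw [hD]; trivial
    exact this
  exact hsub (S.mem_closure_range_smear μ a)

end CStarSystem

/-! ### Systems with the same factor system -/

section EqualFactorSystems

open CStarSystem FactorData MeasureTheory

variable {G : Type*} [Group G] [TopologicalSpace G]
variable {A : Type*} [CStarAlgebra A] {A' : Type*} [CStarAlgebra A'] {B : Type*} [CStarAlgebra B]

/-- The coefficients `y` with `u s̄_σ = s_τ y`, for an intertwiner `u` from the conjugate of `σ` to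
`τ`, see `FactorData.IsAssociatedVia.map_mul_map_star`. -/
noncomputable def FactorData.conjCoeff (F : FactorData G B) (σ τ : UnitaryDual G)
    (u : Matrix (Fin τ.dim) (Fin σ.dim) ℂ) : Matrix (Fin τ.dim) (Fin σ.dim) B :=
  Matrix.of fun j i => star (∑ p : Fin σ.dim × Fin τ.dim,
    algebraMap ℂ B (star (u p.2 p.1)) * F.ω σ τ p (i, j))

/-- The conjugate of `s_σ` in terms of the family `s` and of `(γ, ω)`. With `r` the invariant
functional on `V_σ ⊗ V_τ` that corresponds to `u`, the adjoint of the coefficient `s_τ* u s̄_σ` is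
the contraction of `(s_σ)₁₂ (s_τ)₁₃ = s_{σ ⊗ τ} ω(σ, τ)` with `r`, and `r s_{σ ⊗ τ} = r`. -/
theorem FactorData.IsAssociatedVia.map_mul_map_star {F : FactorData G B} {S : CStarSystem G A B}
    {s : ∀ σ : UnitaryDual G, Matrix (Fin σ.dim) (Fin σ.dim) A} (h : F.IsAssociatedVia S s)
    (σ τ : UnitaryDual G) (u : Matrix (Fin τ.dim) (Fin σ.dim) ℂ)
    (hu : ∀ g, u * σ.rep.conj.mat g = τ.rep.mat g * u) :
    u.map (algebraMap ℂ A) * (s σ).map star = s τ * (F.conjCoeff σ τ u).map S.incl := by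
  have hx : S.IsIsotypic τ.rep (u.map (algebraMap ℂ A) * (s σ).map star) :=
    (h.1 σ).isIsotypic.conj.intertwine hu
  rw [← (h.1 τ).mul_conjTranspose_mul hx]
  congr 1
  -- `r` is the invariant functional on `V_σ ⊗ V_τ` that corresponds to `u`.
  let r : Matrix Unit (Fin σ.dim × Fin τ.dim) ℂ := Matrix.of fun _ p => star (u p.2 p.1)
  have hr : ∀ g, r * (σ.rep.tensor τ.rep).mat g = r := fun g => by
    have h1 : (τ.rep.mat g)ᴴ * (u * σ.rep.conj.mat g) = u := by
      rw [hu, ← Matrix.mul_assoc, τ.rep.conjTranspose_mat, ← τ.rep.mat_mul, inv_mul_cancel,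
        τ.rep.mat_one, Matrix.one_mul]
    ext a ⟨i, j⟩
    have h2 := congrArg star (congrFun (congrFun h1 j) i)
    rw [show r a (i, j) = star (u j i) from rfl, ← h2,
      show (σ.rep.tensor τ.rep).mat g = σ.rep.mat g ⊗ₖ τ.rep.mat g from rfl]
    simp only [Matrix.mul_apply, Fintype.sum_prod_type, r, Matrix.of_apply,
      Matrix.kroneckerMap_apply, Matrix.conjTranspose_apply, UnitaryRep.conj_mat, Matrix.map_apply,
      star_sum, star_mul', Finset.mul_sum, star_star]
    rw [Finset.sum_comm]
    refine Finset.sum_congr rfl fun l _ => Finset.sum_congr rfl fun k _ => ?_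
    simp only [RCLike.star_def, Complex.conj_conj]
    ring
  have h3 := congrArg (fun M => r.map (algebraMap ℂ A) * M) (h.extendFamily_mul_omega σ τ)
  rw [← Matrix.mul_assoc, mul_extendFamily_of_trivial h.2.1 _ r hr] at h3
  ext j i
  have h4 := congrArg star (congrFun (congrFun h3 ()) (i, j))
  simp only [Matrix.mul_apply, Matrix.map_apply, Matrix.kroneckerMap_apply, r, Matrix.of_apply]
    at h4
  simp only [conjCoeff, Matrix.map_apply, Matrix.of_apply, map_star, map_sum, map_mul,
    AlgHomClass.commutes]
  rw [h4]
  simp only [Matrix.mul_apply, Matrix.conjTranspose_apply, Matrix.map_apply, Fintype.sum_prod_type,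
    star_sum, star_mul, Finset.mul_sum, ← algebraMap_star_comm, star_star]
  rw [Finset.sum_comm]
  refine Finset.sum_congr rfl fun k _ => Finset.sum_congr rfl fun l _ => ?_
  rw [mul_assoc, Algebra.commutes]

/-- The span in `A × A'` of all pairs of corresponding entries of `s_σ y` and `s'_σ y`, where
`y ∈ B ⊗ End(V_σ)`. If both systems have the same factor system, this is a *-algebra, and it is the
graph of a densely defined isometry. -/
noncomputable def correspondence (S : CStarSystem G A B) (S' : CStarSystem G A' B)
    (s : ∀ σ : UnitaryDual G, Matrix (Fin σ.dim) (Fin σ.dim) A)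
    (s' : ∀ σ : UnitaryDual G, Matrix (Fin σ.dim) (Fin σ.dim) A') : Submodule ℂ (A × A') :=
  Submodule.span ℂ {p | ∃ (σ : UnitaryDual G) (y : Matrix (Fin σ.dim) (Fin σ.dim) B)
    (i j : Fin σ.dim), p = ((s σ * y.map S.incl) i j, (s' σ * y.map S'.incl) i j)}

section Correspondence

variable {F : FactorData G B} {S : CStarSystem G A B} {S' : CStarSystem G A' B}
variable {s : ∀ σ : UnitaryDual G, Matrix (Fin σ.dim) (Fin σ.dim) A}
variable {s' : ∀ σ : UnitaryDual G, Matrix (Fin σ.dim) (Fin σ.dim) A'}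

theorem correspondence_swap {p : A × A'} (hp : p ∈ correspondence S S' s s') :
    p.swap ∈ correspondence S' S s' s := by
  refine Submodule.span_induction (p := fun p _ => p.swap ∈ correspondence S' S s' s) ?_ ?_ ?_ ?_ hp
  · rintro _ ⟨σ, y, i, j, rfl⟩
    exact Submodule.subset_span ⟨σ, y, i, j, rfl⟩
  · exact Submodule.zero_mem _
  · intro p q _ _ hp hq
    exact Submodule.add_mem _ hp hq
  · intro c p _ hp
    exact Submodule.smul_mem _ c hp

theorem mul_map_mem_correspondence {l : Type*} (σ : UnitaryDual G) (y : Matrix (Fin σ.dim) l B)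
    (i : Fin σ.dim) (j : l) :
    ((s σ * y.map S.incl) i j, (s' σ * y.map S'.incl) i j) ∈ correspondence S S' s s' := by
  refine Submodule.subset_span ⟨σ, Matrix.of fun a _ => y a j, i, i, ?_⟩
  simp [Matrix.mul_apply]

theorem scalar_mul_mem_correspondence {l m n : Type*} [Fintype m] (M : Matrix n m ℂ)
    {x : Matrix m l A} {x' : Matrix m l A'}
    (hx : ∀ i j, (x i j, x' i j) ∈ correspondence S S' s s') (i : n) (j : l) :
    ((M.map (algebraMap ℂ A) * x) i j, (M.map (algebraMap ℂ A') * x') i j) ∈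
      correspondence S S' s s' := by
  have : ((M.map (algebraMap ℂ A) * x) i j, (M.map (algebraMap ℂ A') * x') i j) =
      ∑ k, M i k • (x k j, x' k j) := by
    ext <;> simp [Matrix.mul_apply, Algebra.smul_def, Prod.fst_sum, Prod.snd_sum]
  rw [this]
  exact Submodule.sum_mem _ fun k _ => Submodule.smul_mem _ _ (hx k j)

theorem sum_mem_correspondence {ι : Type*} [Fintype ι] {l n : Type*}
    {x : ι → Matrix n l A} {x' : ι → Matrix n l A'}
    (hx : ∀ k i j, (x k i j, x' k i j) ∈ correspondence S S' s s') (i : n) (j : l) :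
    ((∑ k, x k) i j, (∑ k, x' k) i j) ∈ correspondence S S' s s' := by
  have : ((∑ k, x k) i j, (∑ k, x' k) i j) = ∑ k, (x k i j, x' k i j) := by
    ext <;> simp [Matrix.sum_apply, Prod.fst_sum, Prod.snd_sum]
  rw [this]
  exact Submodule.sum_mem _ fun k _ => hx k i j

theorem extendFamily_mul_map_mem_correspondence {n l : Type*} [Fintype n] [DecidableEq n]
    (π : UnitaryRep G n) (y : Matrix n l B) (i : n) (j : l) :
    ((extendFamily s π * y.map S.incl) i j, (extendFamily s' π * y.map S'.incl) i j) ∈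
      correspondence S S' s s' := by
  rw [extendFamily_eq, extendFamily_eq, Matrix.sum_mul, Matrix.sum_mul]
  simp only [Matrix.mul_assoc]
  simp only [← Matrix.map_scalar_of_hom S.incl ((π.decomposition.isom _)ᴴ),
    ← Matrix.map_scalar_of_hom S'.incl ((π.decomposition.isom _)ᴴ), ← Matrix.map_mul_of_hom]
  exact sum_mem_correspondence (fun k => scalar_mul_mem_correspondence _
    (mul_map_mem_correspondence _ _)) i j

theorem incl_mem_correspondence (h : F.IsAssociatedVia S s) (h' : F.IsAssociatedVia S' s') (b : B) :
    (S.incl b, S'.incl b) ∈ correspondence S S' s s' := by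
  obtain ⟨σ, hσ⟩ := UnitaryDual.exists_mat_eq_one G
  obtain ⟨i⟩ := σ.isIrreducible_rep.nonempty
  have := mul_map_mem_correspondence (S := S) (S' := S') (s := s) (s' := s') σ
    (Matrix.scalar _ b) i i
  rw [h.2.1 σ hσ, h'.2.1 σ hσ] at this
  simpa using this

theorem mul_mem_correspondence (h : F.IsAssociatedVia S s) (h' : F.IsAssociatedVia S' s')
    {p q : A × A'} (hp : p ∈ correspondence S S' s s') (hq : q ∈ correspondence S S' s s') :
    p * q ∈ correspondence S S' s s' := by
  refine Submodule.span_induction₂ (p := fun p q _ _ => p * q ∈ correspondence S S' s s')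
    ?_ ?_ ?_ ?_ ?_ ?_ ?_ hp hq
  · rintro _ _ ⟨σ, y, i, j, rfl⟩ ⟨τ, z, k, l, rfl⟩
    have h1 := congrFun (congrFun (h.kronecker_mul σ τ y z) (i, k)) (j, l)
    have h2 := congrFun (congrFun (h'.kronecker_mul σ τ y z) (i, k)) (j, l)
    rw [Matrix.kroneckerMap_apply] at h1 h2
    rw [Prod.mk_mul_mk, h1, h2]
    exact extendFamily_mul_map_mem_correspondence _ _ _ _
  · intro p _
    rw [zero_mul]
    exact Submodule.zero_mem _
  · intro p _
    rw [mul_zero]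
    exact Submodule.zero_mem _
  · intro p q r _ _ _ h1 h2
    rw [add_mul]
    exact Submodule.add_mem _ h1 h2
  · intro p q r _ _ _ h1 h2
    rw [mul_add]
    exact Submodule.add_mem _ h1 h2
  · intro c p q _ _ h1
    rw [smul_mul_assoc]
    exact Submodule.smul_mem _ _ h1
  · intro c p q _ _ h1
    rw [mul_smul_comm]
    exact Submodule.smul_mem _ _ h1

theorem star_entry_mem_correspondence (h : F.IsAssociatedVia S s) (h' : F.IsAssociatedVia S' s')
    (σ : UnitaryDual G) (i j : Fin σ.dim) :
    (star (s σ i j), star (s' σ i j)) ∈ correspondence S S' s s' := by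
  have key : ((s σ).map star i j, (s' σ).map star i j) ∈ correspondence S S' s s' := by
    rw [← σ.rep.conj.decomposition.sum_map_isom ((s σ).map star),
      ← σ.rep.conj.decomposition.sum_map_isom ((s' σ).map star)]
    generalize σ.rep.conj.decomposition = D
    simp only [h.map_mul_map_star _ _ _ (D.conjTranspose_isom_intertwines _),
      h'.map_mul_map_star _ _ _ (D.conjTranspose_isom_intertwines _)]
    exact sum_mem_correspondence (fun k => scalar_mul_mem_correspondence _
      (mul_map_mem_correspondence _ _)) i j
  exact key

theorem star_mem_correspondence (h : F.IsAssociatedVia S s) (h' : F.IsAssociatedVia S' s')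
    {p : A × A'} (hp : p ∈ correspondence S S' s s') : star p ∈ correspondence S S' s s' := by
  refine Submodule.span_induction (p := fun p _ => star p ∈ correspondence S S' s s')
    ?_ ?_ ?_ ?_ hp
  · rintro _ ⟨σ, y, i, j, rfl⟩
    have : star ((s σ * y.map S.incl) i j, (s' σ * y.map S'.incl) i j) =
        ∑ k, (S.incl (star (y k j)), S'.incl (star (y k j))) *
          (star (s σ i k), star (s' σ i k)) := by
      ext <;> simp [Matrix.mul_apply, Prod.fst_sum, Prod.snd_sum, map_star]
    rw [this]
    exact Submodule.sum_mem _ fun k _ => mul_mem_correspondence h h'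
      (incl_mem_correspondence h h' _) (star_entry_mem_correspondence h h' σ i k)
  · rw [star_zero]
    exact Submodule.zero_mem _
  · intro p q _ _ hp hq
    rw [star_add]
    exact Submodule.add_mem _ hp hq
  · intro c p _ hp
    rw [star_smul]
    exact Submodule.smul_mem _ _ hp

theorem act_mem_correspondence (h : F.IsAssociatedVia S s) (h' : F.IsAssociatedVia S' s')
    (g : G) {p : A × A'} (hp : p ∈ correspondence S S' s s') :
    (S.act g p.1, S'.act g p.2) ∈ correspondence S S' s s' := by
  refine Submodule.span_induction
    (p := fun p _ => (S.act g p.1, S'.act g p.2) ∈ correspondence S S' s s') ?_ ?_ ?_ ?_ hp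
  · rintro _ ⟨σ, y, i, j, rfl⟩
    have h1 := isIsotypic_iff.1 ((h.1 σ).isIsotypic.mul (isFixed_map_incl y)) g
    have h2 := isIsotypic_iff.1 ((h'.1 σ).isIsotypic.mul (isFixed_map_incl y)) g
    have h3 := scalar_mul_mem_correspondence (S := S) (S' := S') (s := s) (s' := s')
      (σ.rep.mat g⁻¹) (mul_map_mem_correspondence σ y) i j
    rw [← h1, ← h2] at h3
    exact h3
  · simp only [Prod.fst_zero, Prod.snd_zero, map_zero]
    exact Submodule.zero_mem _
  · intro p q _ _ hp hq
    simp only [Prod.fst_add, Prod.snd_add, map_add]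
    exact Submodule.add_mem _ hp hq
  · intro c p _ hp
    simp only [Prod.smul_fst, Prod.smul_snd, map_smul]
    exact Submodule.smul_mem _ c hp

theorem exists_mem_correspondence_of_mem_isotypicSpan (h : F.IsAssociatedVia S s) {a : A}
    (ha : a ∈ S.isotypicSpan) : ∃ a', (a, a') ∈ correspondence S S' s s' := by
  refine Submodule.span_induction (p := fun a _ => ∃ a', (a, a') ∈ correspondence S S' s s')
    ?_ ?_ ?_ ?_ ha
  · rintro _ ⟨σ, x, hx, i, rfl⟩
    obtain ⟨y, hy⟩ := ((h.1 σ).isIsotypic.conjTranspose_mul hx).exists_map_incl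
    have h1 := mul_map_mem_correspondence (S := S) (S' := S') (s := s) (s' := s') σ y i ()
    rw [hy, (h.1 σ).mul_conjTranspose_mul hx] at h1
    exact ⟨_, h1⟩
  · exact ⟨0, Submodule.zero_mem _⟩
  · rintro a b _ _ ⟨a', ha⟩ ⟨b', hb⟩
    exact ⟨a' + b', Submodule.add_mem _ ha hb⟩
  · rintro c a _ ⟨a', ha⟩
    exact ⟨c • a', Submodule.smul_mem _ c ha⟩

/-- For systems with the same factor system, the correspondence as a *-algebra. -/
noncomputable def correspondenceAlgebra (h : F.IsAssociatedVia S s)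
    (h' : F.IsAssociatedVia S' s') : StarSubalgebra ℂ (A × A') where
  carrier := correspondence S S' s s'
  mul_mem' := mul_mem_correspondence h h'
  add_mem' := Submodule.add_mem _
  star_mem' := star_mem_correspondence h h'
  algebraMap_mem' c := by
    have := Submodule.smul_mem _ c (incl_mem_correspondence h h' (1 : B))
    rw [map_one, map_one] at this
    rw [Algebra.algebraMap_eq_smul_one]
    exact this

theorem swap_mem_topologicalClosure (h : F.IsAssociatedVia S s) (h' : F.IsAssociatedVia S' s')
    {p : A × A'} (hp : p ∈ (correspondenceAlgebra h h').topologicalClosure) :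
    p.swap ∈ (correspondenceAlgebra h' h).topologicalClosure :=
  map_mem_closure continuous_swap hp fun _ hq => correspondence_swap hq

variable [CompactSpace G] [MeasurableSpace G] [BorelSpace G] [IsTopologicalGroup G]
variable (μ : Measure G) [IsProbabilityMeasure μ] [μ.IsMulLeftInvariant]

/-- Corresponding elements `a`, `a'` have the same average in `B`: it only sees the trivial class,
where `s_1 = s'_1 = 1`. -/
theorem exists_average_eq_incl (h : F.IsAssociatedVia S s) (h' : F.IsAssociatedVia S' s')
    {p : A × A'} (hp : p ∈ correspondence S S' s s') :
    ∃ b, S.average μ p.1 = S.incl b ∧ S'.average μ p.2 = S'.incl b := by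
  refine Submodule.span_induction
    (p := fun p _ => ∃ b, S.average μ p.1 = S.incl b ∧ S'.average μ p.2 = S'.incl b) ?_ ?_ ?_ ?_ hp
  · rintro _ ⟨σ, y, i, j, rfl⟩
    by_cases hσ : ∀ g, σ.rep.mat g = 1
    · refine ⟨y i j, ?_⟩
      simp only [h.2.1 σ hσ, h'.2.1 σ hσ, Matrix.one_mul, Matrix.map_apply, average_incl, and_self]
    · refine ⟨0, ?_, ?_⟩
      · rw [map_zero]
        exact average_isotypic_eq_zero μ σ.isIrreducible_rep hσ
          ((h.1 σ).isIsotypic.mul (isFixed_map_incl y)) i j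
      · rw [map_zero]
        exact average_isotypic_eq_zero μ σ.isIrreducible_rep hσ
          ((h'.1 σ).isIsotypic.mul (isFixed_map_incl y)) i j
  · exact ⟨0, by simp, by simp⟩
  · rintro p q _ _ ⟨b, hb, hb'⟩ ⟨c, hc, hc'⟩
    exact ⟨b + c, by simp [hb, hc], by simp [hb', hc']⟩
  · rintro c p _ ⟨b, hb, hb'⟩
    exact ⟨c • b, by simp [hb], by simp [hb']⟩

/-- Corresponding elements have the same averages, and the average determines the norm. -/
theorem norm_fst_le_norm_snd [μ.IsOpenPosMeasure] (h : F.IsAssociatedVia S s)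
    (h' : F.IsAssociatedVia S' s') {p : A × A'} (hp : p ∈ correspondence S S' s s') :
    ‖p.1‖ ≤ ‖p.2‖ := by
  let _ : PartialOrder A := CStarAlgebra.spectralOrder A
  have _ : StarOrderedRing A := CStarAlgebra.spectralOrderedRing A
  have hq : star p * p ∈ correspondence S S' s s' :=
    mul_mem_correspondence h h' (star_mem_correspondence h h' hp) hp
  have hpow : ∀ n : ℕ, (star p * p) ^ (n + 1) ∈ correspondence S S' s s' := fun n => by
    induction n with
    | zero => simpa using hq
    | succ n ih =>
      rw [pow_succ]
      exact mul_mem_correspondence h h' ih hq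
  have hle : ‖star p.1 * p.1‖ ≤ ‖star p.2 * p.2‖ := by
    refine norm_le_of_forall_norm_map_pow_le (E := S.average μ) (fun a => S.average_nonneg μ)
      (fun a => S.eq_zero_of_average_eq_zero μ) (star_mul_self_nonneg p.1) (norm_nonneg _) fun n => ?_
    obtain ⟨b, hb, hb'⟩ := exists_average_eq_incl μ h h' (hpow n)
    have h1 : ((star p * p) ^ (n + 1)).1 = (star p.1 * p.1) ^ (n + 1) := rfl
    have h2 : ((star p * p) ^ (n + 1)).2 = (star p.2 * p.2) ^ (n + 1) := rfl
    rw [h1] at hb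
    rw [h2] at hb'
    rw [hb, norm_incl, ← S'.norm_incl, ← hb']
    exact (S'.norm_average_le μ _).trans (norm_pow_le' _ n.succ_pos)
  rw [CStarRing.norm_star_mul_self, CStarRing.norm_star_mul_self] at hle
  exact le_of_sq_le_sq (by simpa only [sq] using hle) (norm_nonneg _)

theorem norm_fst_eq_norm_snd [μ.IsOpenPosMeasure] (h : F.IsAssociatedVia S s)
    (h' : F.IsAssociatedVia S' s') {p : A × A'} (hp : p ∈ correspondence S S' s s') :
    ‖p.1‖ = ‖p.2‖ :=
  le_antisymm (norm_fst_le_norm_snd μ h h' hp)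
    (norm_fst_le_norm_snd μ h' h (correspondence_swap hp))

end Correspondence

/-! ### The isomorphism of systems with the same factor system -/

section Isomorphism

variable [IsTopologicalGroup G] [CompactSpace G]
variable {F : FactorData G B} {S : CStarSystem G A B} {S' : CStarSystem G A' B}
variable {s : ∀ σ : UnitaryDual G, Matrix (Fin σ.dim) (Fin σ.dim) A}
variable {s' : ∀ σ : UnitaryDual G, Matrix (Fin σ.dim) (Fin σ.dim) A'}

theorem exists_haar_probability (G : Type*) [Group G] [TopologicalSpace G] [IsTopologicalGroup G]
    [CompactSpace G] [MeasurableSpace G] [BorelSpace G] :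
    ∃ μ : Measure G, IsProbabilityMeasure μ ∧ μ.IsMulLeftInvariant ∧ μ.Regular ∧
      μ.IsOpenPosMeasure :=
  ⟨Measure.haarMeasure ⊤, ⟨Measure.haarMeasure_self⟩, inferInstance, inferInstance, inferInstance⟩

theorem mem_closure_isotypicSpan (S : CStarSystem G A B) (a : A) :
    a ∈ closure (S.isotypicSpan : Set A) := by
  borelize G
  obtain ⟨μ, _, _, _, _⟩ := exists_haar_probability G
  rw [← Submodule.topologicalClosure_coe, S.topologicalClosure_isotypicSpan μ]
  trivial

theorem norm_fst_eq_norm_snd_of_mem_topologicalClosure (h : F.IsAssociatedVia S s)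
    (h' : F.IsAssociatedVia S' s') {p : A × A'}
    (hp : p ∈ (correspondenceAlgebra h h').topologicalClosure) : ‖p.1‖ = ‖p.2‖ := by
  borelize G
  obtain ⟨μ, _, _, _, _⟩ := exists_haar_probability G
  have hclosed : IsClosed {p : A × A' | ‖p.1‖ = ‖p.2‖} :=
    isClosed_eq continuous_fst.norm continuous_snd.norm
  exact closure_minimal (fun q hq => norm_fst_eq_norm_snd μ h h' hq) hclosed hp

/-- The closure of the correspondence projects bijectively to `A`: isometrically by the norm
formula, and with dense range as the isotypic components span a dense subspace. -/
theorem bijective_fst_topologicalClosure (h : F.IsAssociatedVia S s)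
    (h' : F.IsAssociatedVia S' s') :
    Function.Bijective ((StarAlgHom.fst ℂ A A').comp
      (correspondenceAlgebra h h').topologicalClosure.subtype) := by
  set C := (correspondenceAlgebra h h').topologicalClosure with hC
  set f := (StarAlgHom.fst ℂ A A').comp C.subtype
  have hnorm : ∀ p : C, ‖f p‖ = ‖p‖ := fun p => by
    have h1 := norm_fst_eq_norm_snd_of_mem_topologicalClosure h h' p.2
    change ‖(p : A × A').1‖ = ‖(p : A × A')‖
    rw [Prod.norm_def, ← h1, max_self]
  have hiso : Isometry f := AddMonoidHomClass.isometry_of_norm f hnorm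
  refine ⟨hiso.injective, fun a => ?_⟩
  have : CompleteSpace C :=
    (StarSubalgebra.isClosed_topologicalClosure (correspondenceAlgebra h h')).completeSpace_coe
  have hclosed : IsClosed (Set.range f) := hiso.isClosedEmbedding.isClosed_range
  refine closure_minimal (fun b hb => ?_) hclosed (mem_closure_isotypicSpan S a)
  obtain ⟨b', hb'⟩ := exists_mem_correspondence_of_mem_isotypicSpan (S' := S') (s' := s') h hb
  exact ⟨⟨(b, b'), StarSubalgebra.le_topologicalClosure _ hb'⟩, rfl⟩

theorem bijective_snd_topologicalClosure (h : F.IsAssociatedVia S s)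
    (h' : F.IsAssociatedVia S' s') :
    Function.Bijective ((StarAlgHom.snd ℂ A A').comp
      (correspondenceAlgebra h h').topologicalClosure.subtype) := by
  obtain ⟨hinj, hsurj⟩ := bijective_fst_topologicalClosure h' h
  refine ⟨fun p q hpq => ?_, fun a => ?_⟩
  · have := @hinj ⟨_, swap_mem_topologicalClosure h h' p.2⟩
      ⟨_, swap_mem_topologicalClosure h h' q.2⟩ hpq
    exact Subtype.ext (Prod.swap_injective (congrArg Subtype.val this))
  · obtain ⟨p, hp⟩ := hsurj a
    exact ⟨⟨_, swap_mem_topologicalClosure h' h p.2⟩, hp⟩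

/-- Systems with a common factor system are equivalent, through the isomorphism whose graph is the
closure of the correspondence. -/
theorem FactorData.IsAssociatedVia.equivalent (h : F.IsAssociatedVia S s)
    (h' : F.IsAssociatedVia S' s') : S.Equivalent S' := by
  let C := (correspondenceAlgebra h h').topologicalClosure
  let e₁ : C ≃⋆ₐ[ℂ] A := StarAlgEquiv.ofBijective _ (bijective_fst_topologicalClosure h h')
  let e₂ : C ≃⋆ₐ[ℂ] A' := StarAlgEquiv.ofBijective _ (bijective_snd_topologicalClosure h h')
  have hφ : ∀ p (hp : p ∈ C), (e₁.symm.trans e₂) p.1 = p.2 := fun p hp => by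
    have h1 : e₁ ⟨p, hp⟩ = p.1 := rfl
    rw [← h1, StarAlgEquiv.trans_apply, e₁.symm_apply_apply]
    rfl
  have hact : ∀ g, ∀ p ∈ C, (S.act g p.1, S'.act g p.2) ∈ C := fun g p hp => by
    have hc : Continuous fun p : A × A' => (S.act g p.1, S'.act g p.2) := by
      have h1 : Continuous (S.act g) :=
        (AddMonoidHomClass.isometry_of_norm (S.act g) (S.norm_act g)).continuous
      have h2 : Continuous (S'.act g) :=
        (AddMonoidHomClass.isometry_of_norm (S'.act g) (S'.norm_act g)).continuous
      fun_prop
    exact map_mem_closure (f := fun p : A × A' => (S.act g p.1, S'.act g p.2)) hc hp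
      fun q hq => act_mem_correspondence h h' g hq
  refine ⟨e₁.symm.trans e₂, fun g a => ?_, fun b => ?_⟩
  · obtain ⟨p, rfl⟩ := e₁.surjective a
    have h1 := hφ _ (hact g p p.2)
    have h2 := hφ _ p.2
    exact h1.trans (congrArg (S'.act g) h2.symm)
  · exact hφ (S.incl b, S'.incl b)
      (StarSubalgebra.le_topologicalClosure _ (incl_mem_correspondence h h' b))

end Isomorphism

end EqualFactorSystems

/-! ### Equivalence and conjugacy -/

theorem mainTheorem1 {G : Type*} [Group G] [TopologicalSpace G] [IsTopologicalGroup G]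
    [CompactSpace G] [T2Space G] {A A' B : Type*} [CStarAlgebra A] [CStarAlgebra A']
    [CStarAlgebra B] (S : CStarSystem G A B) (S' : CStarSystem G A' B)
    (hS : S.IsWeaklyCleft) (hS' : S'.IsWeaklyCleft)
    (F F' : FactorData G B) (hF : F.IsAssociated S) (hF' : F'.IsAssociated S') :
    S.Equivalent S' ↔ F.Conjugated F' := by
  obtain ⟨s, hs⟩ := hF
  obtain ⟨s', hs'⟩ := hF'
  constructor
  · rintro ⟨φ, hφ, hφB⟩
    exact hs.conjugated (hs'.of_equiv φ hφ hφB)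
  · rintro ⟨v, hv, hγ, hω⟩
    exact (hs.of_conjugacy hs' hv hγ hω).equivalent hs'
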